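/- Let $n\ge 2$ be even and $k\ge 2$. The servers of $\mathrm{DPillar}_{n,k}$ are the pairs $(c,v)$ with a column $c\in\{0,\dots,k-1\}$ and a row-index $v=v_{k-1}\cdots v_0$, $v_i\in\{0,\dots,\frac n2-1\}$. For every column $c$ and every string of $k-1$ values indexed by the positions $i\neq c$ there is a switch; it is linked to exactly those servers of columns $c$ and $c+1$ (columns are taken modulo $k$) whose row-index, with $v_c$ deleted, is that string. Two distinct servers are adjacent if they are linked to a common switch, and the length of a path is the number of its server-switch-server steps. From a server in column $c$ a step is of one of four types: a c-step leads to column $c+1$ and may change only $v_c$; an a-step leads to column $c-1$ and may change only $v_{c-1}$; a b-step stays in column $c$ and changes only $v_c$; a d-step stays in column $c$ and changes only $v_{c-1}$. A path is output as the list of the types of its steps, each with the new value of the bit concerned. The algorithm DPillarMin, on input of two distinct servers $src$ and $dst$, renumbers columns and bit positions relative to the column of $src$, so that $src$ lies in column $0$ and $dst$ in column $x$. Let $B$ be the set of positions at which the two row-indices differ, $\Delta_j=1$ if $j\in B$ and $\Delta_j=0$ otherwise; let $i_1<\dots<i_r$ be the elements of $B$ in $\{x+1,\dots,k-1\}$ and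 $j_s<\dots<j_1$ those in $\{1,\dots,x-1\}$; if $r\ge2$ let $l$ maximize $\delta=i_{l+1}-i_l$, and if $s\ge 2$ let $m$ maximize $\epsilon=j_m-j_{m+1}$. DPillarMin compares the lengths of the following candidate sequences of steps and outputs one of least length, every step setting its bit to the value in $dst$. If $x\ne0$: $c^{k+x}$ and $a^{2k-x}$; if $r=0$, $c^xb^{\Delta_x}$; if $s=0$, $b^{\Delta_0}a^{k-x}$; if $r\ge1$, $a^{k-i_1-1}dc^{k-i_1-1+x}b^{\Delta_x}$ and $c^{i_r}ba^{i_r-x}$; if $s\ge1$, $b^{\Delta_0}a^{k-j_s-1}dc^{x-j_s-1}$ and $c^{j_1}ba^{k+j_1-x}$; if $r\ge2$, $a^{k-i_{l+1}-1}dc^{k-i_{l+1}-1+i_l}ba^{i_l-x}$; if $s\ge2$, $c^{j_{m+1}}ba^{j_{m+1}+k-j_m-1}dc^{x-j_m-1}$. If $x=0$: if $r=0$, $b$; if $r=1$ and $i_1=k-1$, $b^{\Delta_0}d$; if $r=1$ and $i_1=1\ne k-1$, $cba$; if $r=1$ and $1\ne i_1\ne k-1$, $b^{\Delta_0}a^{k-i_1-1}dc^{k-i_1-1}$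 and $c^{i_1}ba^{i_1}$; if $r\ge2$, $c^k$, $a^{k-i_{l+1}-1}dc^{k-i_{l+1}-1+i_l}ba^{i_l}$, $b^{\Delta_0}a^{k-i_1-1}dc^{k-i_1-1}$ and $c^{i_r}ba^{i_r}$. **Theorem.** For all even $n\ge2$, all $k\ge2$ and any two distinct servers $src$, $dst$ of $\mathrm{DPillar}_{n,k}$, DPillarMin outputs a shortest path from $src$ to $dst$. Moreover it computes this path in time $O(k)$: implemented on a random access machine on which additions, subtractions, comparisons, accesses to a register or an array cell and the output of one step each cost one unit of time, it makes at most $Ck$ steps, for a constant $C$ that depends neither on $n$ and $k$ nor on the servers. -/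

import Mathlib

namespace DPillar

/-! ### The data centre network -/

/-- A server `(c, v_{k-1} … v_0)`: its column-index `c` and its row-index `v`, a string of `k`
"bits" with values in `{0, …, n/2 - 1}`. -/
@[ext]
structure Server (n k : ℕ) where
  col : Fin k
  row : Fin k → Fin (n / 2)

/-- A switch of column `c` (between server-columns `c` and `c + 1`); its name is a string of
`k - 1` bits, indexed by the bit positions other than `c`. -/
structure Switch (n k : ℕ) where
  col : Fin k
  name : {i : Fin k // i ≠ col} → Fin (n / 2)

/-- Column `c + 1` (modulo `k`). -/
def next {k : ℕ} (c : Fin k) : Fin k := ⟨(c.val + 1) % k, Nat.mod_lt _ c.pos⟩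

/-- Column `c - 1` (modulo `k`). -/
def prev {k : ℕ} (c : Fin k) : Fin k := ⟨(c.val + (k - 1)) % k, Nat.mod_lt _ c.pos⟩

/-- The server-switch links: a switch in column `c` is linked to the servers of columns `c` and
`c + 1` whose row-index with bit `c` deleted is the name of the switch. -/
def Linked {n k : ℕ} (u : Server n k) (w : Switch n k) : Prop :=
  (u.col = w.col ∨ u.col = next w.col) ∧ ∀ i : {i : Fin k // i ≠ w.col}, w.name i = u.row i

/-- `DPillar_{n,k}` as a graph on the servers: the edges are the server-switch-server link pairs.
The length of a path between servers is the number of these pairs. -/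
def graph (n k : ℕ) : SimpleGraph (Server n k) where
  Adj u v := u ≠ v ∧ ∃ w : Switch n k, Linked u w ∧ Linked v w
  symm := ⟨fun _ _ h => ⟨h.1.symm, h.2.imp fun _ hw => ⟨hw.2, hw.1⟩⟩⟩
  loopless := ⟨fun _ h => h.1 rfl⟩

/-- The four types of edges: anti-clockwise, basic static, clockwise, decremented static. -/
inductive Move where
  | a | b | c | d

/-- The column reached from column `j` by a move. -/
def Move.target {k : ℕ} : Move → Fin k → Fin k
  | .a, j => prev j
  | .b, j => j
  | .c, j => next j
  | .d, j => j

/-- The column covered by a move made in column `j`, i.e. the bit position that it may change. -/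
def Move.covers {k : ℕ} : Move → Fin k → Fin k
  | .a, j => prev j
  | .b, j => j
  | .c, j => j
  | .d, j => prev j

/-- One item of a routing output: the type of the edge to be followed and the value that the
covered bit has at its end. -/
structure Hop where
  move : Move
  digit : ℕ

/-- Following the hop `h` from the server `u` leads to the server `v`. -/
def Hop.Leads {n k : ℕ} (h : Hop) (u v : Server n k) : Prop :=
  v.col = h.move.target u.col ∧
  (v.row (h.move.covers u.col)).val = h.digit ∧
  ∀ i : Fin k, i ≠ h.move.covers u.col → v.row i = u.row i

/-- The list of hops describes, edge by edge, the given walk of `DPillar_{n,k}`. -/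
def Describes {n k : ℕ} : {u v : Server n k} → List Hop → (graph n k).Walk u v → Prop
  | _, _, [], .nil => True
  | _, _, h :: hs, @SimpleGraph.Walk.cons _ _ u v _ _ p => h.Leads u v ∧ Describes hs p
  | _, _, _, _ => False

/-! ### The machine model

A random access machine with finitely many named registers and finitely many named arrays of
natural numbers, programmed in a structured language. Addition, subtraction, comparison,
access to a register or an array cell, and output of one hop take unit time each. -/

/-- The registers used by the algorithm. -/
inductive Reg where
  -- inputs: the dimension and the two column-indices
  | k | srcCol | dstCol
  -- counters and positions
  | i | p
  -- the column of the destination relative to the source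
  | x
  -- the quantities `r`, `i_1`, `i_r`, `δ` and the pair of nodes at which `δ` is attained
  | r | i₁ | iᵣ | δ | δlo | δhi
  -- the quantities `s`, `j_1`, `j_s`, `ε` and the pair of nodes at which `ε` is attained
  | s | j₁ | jₛ | ε | εlo | εhi
  | Δ₀ | Δₓ
  -- the length of the best path so far, and the exponents of that path, written as
  -- `c^{e₁} b^{e₂} a^{e₃} d^{e₄} c^{e₅} b^{e₆} a^{e₇}`
  | L | e₁ | e₂ | e₃ | e₄ | e₅ | e₆ | e₇
  deriving DecidableEq

/-- The arrays: the two row-indices (inputs), the indicator of the set `B` of marked nodes and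
the destination's bits, the last two indexed by the column relative to the source. -/
inductive Arr where
  | src | dst | B | fix
  deriving DecidableEq

/-- Arithmetic expressions; `sub` is truncated at `0`. -/
inductive Expr where
  | lit (m : ℕ)
  | reg (v : Reg)
  | get (A : Arr) (e : Expr)
  | add (e f : Expr)
  | sub (e f : Expr)

/-- Tests. -/
inductive Test where
  | lt (e f : Expr)
  | eq (e f : Expr)
  | not (t : Test)
  | and (t u : Test)

/-- Programs. `loop v e body` evaluates `e` once, to `N` say, and executes `body` for
`v = 0, 1, …, N - 1`. -/
inductive Stmt where
  | skip
  | set (v : Reg) (e : Expr)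
  | put (A : Arr) (e f : Expr)
  | emit (m : Move) (e : Expr)
  | seq (P Q : Stmt)
  | cond (t : Test) (P Q : Stmt)
  | loop (v : Reg) (e : Expr) (body : Stmt)

/-- Contents of the registers and the arrays, and what has been output so far. -/
structure State where
  reg : Reg → ℕ
  arr : Arr → ℕ → ℕ
  out : List Hop

def Expr.eval (σ : State) : Expr → ℕ
  | .lit m => m
  | .reg v => σ.reg v
  | .get A e => σ.arr A (e.eval σ)
  | .add e f => e.eval σ + f.eval σ
  | .sub e f => e.eval σ - f.eval σ

/-- Number of steps taken by the evaluation of an expression. -/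
def Expr.cost : Expr → ℕ
  | .lit _ => 1
  | .reg _ => 1
  | .get _ e => e.cost + 1
  | .add e f => e.cost + f.cost + 1
  | .sub e f => e.cost + f.cost + 1

def Test.eval (σ : State) : Test → Bool
  | .lt e f => decide (e.eval σ < f.eval σ)
  | .eq e f => decide (e.eval σ = f.eval σ)
  | .not t => !(t.eval σ)
  | .and t u => t.eval σ && u.eval σ

/-- Number of steps taken by a test (both arguments of `and` are always evaluated). -/
def Test.cost : Test → ℕ
  | .lt e f => e.cost + f.cost + 1
  | .eq e f => e.cost + f.cost + 1
  | .not t => t.cost + 1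
  | .and t u => t.cost + u.cost + 1

def State.setReg (σ : State) (v : Reg) (m : ℕ) : State :=
  { σ with reg := Function.update σ.reg v m }

def State.setArr (σ : State) (A : Arr) (j m : ℕ) : State :=
  { σ with arr := Function.update σ.arr A (Function.update (σ.arr A) j m) }

/-- Executing a program: the final state together with the number of steps. -/
def Stmt.exec : Stmt → State → State × ℕ
  | .skip, σ => (σ, 1)
  | .set v e, σ => (σ.setReg v (e.eval σ), e.cost + 1)
  | .put A e f, σ => (σ.setArr A (e.eval σ) (f.eval σ), e.cost + f.cost + 1)
  | .emit m e, σ => ({ σ with out := σ.out ++ [⟨m, e.eval σ⟩] }, e.cost + 1)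
  | .seq P Q, σ =>
      let τ := P.exec σ
      let υ := Q.exec τ.1
      (υ.1, τ.2 + υ.2)
  | .cond t P Q, σ =>
      let τ := if t.eval σ then P.exec σ else Q.exec σ
      (τ.1, t.cost + τ.2 + 1)
  | .loop v e body, σ =>
      (List.range (e.eval σ)).foldl
        (fun acc j =>
          let τ := body.exec (acc.1.setReg v j)
          (τ.1, acc.2 + τ.2 + 1))
        (σ, e.cost + 1)

/-! ### The algorithm -/

instance : Coe Reg Expr := ⟨Expr.reg⟩
instance (m : ℕ) : OfNat Expr m := ⟨Expr.lit m⟩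
instance : Add Expr := ⟨Expr.add⟩
instance : Sub Expr := ⟨Expr.sub⟩

def block : List Stmt → Stmt
  | [] => .skip
  | P :: Ps => .seq P (block Ps)

def when (t : Test) (P : Stmt) : Stmt := .cond t P .skip

/-- Make `c^{f₁} b^{f₂} a^{f₃} d^{f₄} c^{f₅} b^{f₆} a^{f₇}`, of length `len`, the current path. -/
def choosePath (len f₁ f₂ f₃ f₄ f₅ f₆ f₇ : Expr) : Stmt :=
  block [.set .L len, .set .e₁ f₁, .set .e₂ f₂, .set .e₃ f₃, .set .e₄ f₄, .set .e₅ f₅,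
    .set .e₆ f₆, .set .e₇ f₇]

/-- `L = min {L, len}`, remembering the corresponding path. -/
def consider (len f₁ f₂ f₃ f₄ f₅ f₆ f₇ : Expr) : Stmt :=
  when (.lt len Reg.L) (choosePath len f₁ f₂ f₃ f₄ f₅ f₆ f₇)

/-- Calculate `x`, the set `B` of marked nodes, and the target values of the bits, all relative to
the column of the source. -/
def calcB : Stmt := block [
  .cond (.lt Reg.dstCol Reg.srcCol)
    (.set .x (Reg.dstCol + Reg.k - Reg.srcCol : Expr))
    (.set .x (Reg.dstCol - Reg.srcCol : Expr)),
  .set .p Reg.srcCol,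
  .loop .i Reg.k (block [
    .cond (.eq (.get .src Reg.p) (.get .dst Reg.p)) (.put .B Reg.i 0) (.put .B Reg.i 1),
    .put .fix Reg.i (.get .dst Reg.p),
    .set .p (Reg.p + 1 : Expr),
    when (.eq Reg.p Reg.k) (.set .p 0)])]

/-- Calculate `Δ₀`, `Δₓ`; `r`, `i_1`, `i_r`, `δ` from the marked nodes `i_1 < … < i_r` in
`{x+1, …, k-1}`; and `s`, `j_1`, `j_s`, `ε` from the marked nodes `j_s < … < j_1` in
`{1, …, x-1}`. -/
def calcParams : Stmt := block [
  .set .Δ₀ (.get .B 0),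
  .set .Δₓ (.get .B Reg.x),
  .set .r 0, .set .δ 0, .set .s 0, .set .ε 0,
  .loop .i Reg.k (block [
    when (.and (.lt Reg.x Reg.i) (.eq (.get .B Reg.i) 1)) (block [
      .cond (.eq Reg.r 0)
        (.set .i₁ Reg.i)
        (when (.lt Reg.δ (Reg.i - Reg.iᵣ : Expr))
          (block [.set .δ (Reg.i - Reg.iᵣ : Expr), .set .δlo Reg.iᵣ, .set .δhi Reg.i])),
      .set .iᵣ Reg.i,
      .set .r (Reg.r + 1 : Expr)]),
    when (.and (.and (.lt 0 Reg.i) (.lt Reg.i Reg.x)) (.eq (.get .B Reg.i) 1)) (block [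
      .cond (.eq Reg.s 0)
        (.set .jₛ Reg.i)
        (when (.lt Reg.ε (Reg.i - Reg.j₁ : Expr))
          (block [.set .ε (Reg.i - Reg.j₁ : Expr), .set .εlo Reg.j₁, .set .εhi Reg.i])),
      .set .j₁ Reg.i,
      .set .s (Reg.s + 1 : Expr)])])]

section Candidates

open Reg

/-- The candidate paths when the source and the destination lie in different columns. In the
lengths the subtractions come last, so that none of them is truncated. -/
def candidatesDistinct : Stmt := block [
  choosePath (k + x) (k + x) 0 0 0 0 0 0,
  consider (k + k - x) 0 0 (k + k - x) 0 0 0 0,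
  when (.eq r 0)
    (consider (x + Δₓ) x Δₓ 0 0 0 0 0),
  when (.eq s 0)
    (consider (k - x + Δ₀) 0 Δ₀ (k - x) 0 0 0 0),
  when (.eq r 1) (block [
    consider (k + k + x + Δₓ - i₁ - i₁ - 1) 0 0 (k - i₁ - 1) 1 (k - i₁ - 1 + x) Δₓ 0,
    consider (i₁ + i₁ + 1 - x) i₁ 1 (i₁ - x) 0 0 0 0]),
  when (.eq s 1) (block [
    consider (k + x + Δ₀ - j₁ - j₁ - 1) 0 Δ₀ (k - j₁ - 1) 1 (x - j₁ - 1) 0 0,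
    consider (k + j₁ + j₁ + 1 - x) j₁ 1 (k + j₁ - x) 0 0 0 0]),
  when (.lt 1 r) (block [
    consider (k + k - δ - δ - x) 0 0 (k - δhi - 1) 1 (k - δhi - 1 + δlo) 1 (δlo - x),
    consider (k + k + x + Δₓ - i₁ - i₁ - 1) 0 0 (k - i₁ - 1) 1 (k - i₁ - 1 + x) Δₓ 0,
    consider (iᵣ + iᵣ + 1 - x) iᵣ 1 (iᵣ - x) 0 0 0 0]),
  when (.lt 1 s) (block [
    consider (k + x - ε - ε) εlo 1 (εlo + k - εhi - 1) 1 (x - εhi - 1) 0 0,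
    consider (k + x + Δ₀ - jₛ - jₛ - 1) 0 Δ₀ (k - jₛ - 1) 1 (x - jₛ - 1) 0 0,
    consider (k + j₁ + j₁ + 1 - x) j₁ 1 (k + j₁ - x) 0 0 0 0])]

/-- The candidate paths when the source and the destination lie in the same column. -/
def candidatesSame : Stmt := block [
  when (.eq r 0)
    (choosePath 1 0 1 0 0 0 0 0),
  when (.eq r 1) (block [
    when (.eq i₁ (k - 1))
      (choosePath (1 + Δ₀) 0 Δ₀ 0 1 0 0 0),
    when (.and (.eq 1 i₁) (.not (.eq i₁ (k - 1))))
      (choosePath 3 1 1 1 0 0 0 0),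
    when (.and (.not (.eq 1 i₁)) (.not (.eq i₁ (k - 1)))) (block [
      choosePath (k + k + Δ₀ - i₁ - i₁ - 1) 0 Δ₀ (k - i₁ - 1) 1 (k - i₁ - 1) 0 0,
      consider (i₁ + i₁ + 1) i₁ 1 i₁ 0 0 0 0])]),
  when (.lt 1 r) (block [
    choosePath k k 0 0 0 0 0 0,
    consider (k + k - δ - δ) 0 0 (k - δhi - 1) 1 (k - δhi - 1 + δlo) 1 δlo,
    consider (k + k + Δ₀ - i₁ - i₁ - 1) 0 Δ₀ (k - i₁ - 1) 1 (k - i₁ - 1) 0 0,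
    consider (iᵣ + iᵣ + 1) iᵣ 1 iᵣ 0 0 0 0])]

end Candidates

/-- Output of a single move from the current relative column `p`, with the covered bit set to the
destination's value. -/
def emitMove : Move → Stmt
  | .a => block [
      when (.eq Reg.p 0) (.set .p Reg.k),
      .set .p (Reg.p - 1 : Expr),
      .emit .a (.get .fix Reg.p)]
  | .b => .emit .b (.get .fix Reg.p)
  | .c => block [
      .emit .c (.get .fix Reg.p),
      .set .p (Reg.p + 1 : Expr),
      when (.eq Reg.p Reg.k) (.set .p 0)]
  | .d => .cond (.eq Reg.p 0)
      (.emit .d (.get .fix (Reg.k - 1 : Expr)))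
      (.emit .d (.get .fix (Reg.p - 1 : Expr)))

/-- Output of the path that was chosen. -/
def outputPath : Stmt := block [
  .set .p 0,
  .loop .i Reg.e₁ (emitMove .c),
  .loop .i Reg.e₂ (emitMove .b),
  .loop .i Reg.e₃ (emitMove .a),
  .loop .i Reg.e₄ (emitMove .d),
  .loop .i Reg.e₅ (emitMove .c),
  .loop .i Reg.e₆ (emitMove .b),
  .loop .i Reg.e₇ (emitMove .a)]

/-- The algorithm DPillarMin, in the version that outputs a path. -/
def dpillarMin : Stmt := block [
  calcB,
  calcParams,
  .cond (.not (.eq 0 Reg.x)) candidatesDistinct candidatesSame,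
  outputPath]

/-- The initial state: the input consists of `k` and the names of the two servers; all other
registers and cells are `0`. -/
def load {n k : ℕ} (src dst : Server n k) : State where
  reg
    | .k => k
    | .srcCol => src.col
    | .dstCol => dst.col
    | _ => 0
  arr
    | .src, j => if h : j < k then src.row ⟨j, h⟩ else 0
    | .dst, j => if h : j < k then dst.row ⟨j, h⟩ else 0
    | _, _ => 0
  out := []

/-- The output of DPillarMin on the given source and destination. -/
def output {n k : ℕ} (src dst : Server n k) : List Hop := (dpillarMin.exec (load src dst)).1.out

/-- The number of steps made by DPillarMin on the given source and destination. -/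
def time {n k : ℕ} (src dst : Server n k) : ℕ := (dpillarMin.exec (load src dst)).2

end DPillar

/-! Unroll the cycle of columns to the integers, with the source at `0`. Each step stays at or
crosses one edge `{e, e + 1}` of the line and can alter only the bit at `e` modulo `k`. Let a walk
range over the positions from `m` to `M` and end at `f`. It alters bits between `m` and `M - 1`, and
possibly, by static steps recorded in `β` and `α`, those at `m - 1` and `M`. Its length is at least
`2 * (M - m) - |f| + α + β` (`Span.step`, `exists_span`).

A walk to the destination has `f = x + k * t`. If `t ≥ 1` or `t ≤ -2`, then `|f|` alone gives `k +
x` or `2 * k - x`. If `t = 0`, the bits in `[0, x)` are passed anyway, and the marked bits of the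
arc `[x, k)` must be reached by overshooting past `x` or by first moving below `0`, two steps for
each extra position apart from the saving of static steps. If `t = -1`, the arc `[0, x)` plays the
same role. It is best to cover such an arc from one side only, or from both sides while sparing a
largest gap between marked bits (`Scanned.cost_le`). Every alternative in `Measured.lower_bound` is
thus at least the length of some candidate.

Conversely, the candidates are genuine walks. A partial route ends in a `blend`: a window `[lo, hi)`
of bits already agrees with the destination. Moves `c` and `a` change the column, as `k ≥ 2`; a
static step is made only at an end of the window, on a marked bit not yet covered, so it changes the
server. Once the window covers all marked bits and the column is right, the destination is reached
(`blend_eq_dst`).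

The remainder verifies the program: loop invariants for the two scans, a monotone comparison of
candidates, and the output loops. The scans have `k` rounds of bounded cost and at most `3 * k` hops
are output, so the time is linear. -/

namespace DPillar

/-! ### Semantics of the programming language -/

/-- The final state of a program. -/
def Stmt.run (P : Stmt) (σ : State) : State := (P.exec σ).1

/-- The number of steps of a program. -/
def Stmt.steps (P : Stmt) (σ : State) : ℕ := (P.exec σ).2

section Run

variable (σ : State)

@[simp] theorem run_skip : Stmt.skip.run σ = σ := rfl

@[simp] theorem run_set (v : Reg) (e : Expr) :
    (Stmt.set v e).run σ = σ.setReg v (e.eval σ) := rfl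

@[simp] theorem run_put (A : Arr) (e f : Expr) :
    (Stmt.put A e f).run σ = σ.setArr A (e.eval σ) (f.eval σ) := rfl

@[simp] theorem run_emit (m : Move) (e : Expr) :
    (Stmt.emit m e).run σ = { σ with out := σ.out ++ [⟨m, e.eval σ⟩] } := rfl

@[simp] theorem run_seq (P Q : Stmt) : (Stmt.seq P Q).run σ = Q.run (P.run σ) := rfl

@[simp] theorem run_cond (t : Test) (P Q : Stmt) :
    (Stmt.cond t P Q).run σ = if t.eval σ then P.run σ else Q.run σ := by
  simp only [Stmt.run, Stmt.exec]
  split_ifs <;> rfl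

@[simp] theorem run_when (t : Test) (P : Stmt) :
    (DPillar.when t P).run σ = if t.eval σ then P.run σ else σ := by
  simp [DPillar.when]

@[simp] theorem run_block_nil : (block []).run σ = σ := rfl

@[simp] theorem run_block_cons (P : Stmt) (Ps : List Stmt) :
    (block (P :: Ps)).run σ = (block Ps).run (P.run σ) := rfl

theorem run_loop (v : Reg) (e : Expr) (body : Stmt) :
    (Stmt.loop v e body).run σ =
      (List.range (e.eval σ)).foldl (fun τ j => body.run (τ.setReg v j)) σ := by
  simp only [Stmt.run, Stmt.exec]
  -- The accumulated cost never influences the state, so the induction may start from any cost.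
  generalize e.cost + 1 = c
  generalize List.range (e.eval σ) = l
  induction l generalizing σ c with
  | nil => rfl
  | cons j l ih => simp only [List.foldl_cons]; exact ih _ _

/-- Loop invariants: `I j` holds when `j` rounds have been completed. -/
theorem run_loop_induction {v : Reg} {e : Expr} {body : Stmt} {σ : State} (I : ℕ → State → Prop)
    (h0 : I 0 σ) (hs : ∀ j < e.eval σ, ∀ τ, I j τ → I (j + 1) (body.run (τ.setReg v j))) :
    I (e.eval σ) ((Stmt.loop v e body).run σ) := by
  rw [run_loop]
  generalize e.eval σ = N at hs
  induction N with
  | zero => exact h0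
  | succ N ih =>
    rw [List.range_succ, List.foldl_append]
    exact hs N N.lt_succ_self _ (ih fun j hj => hs j (hj.trans N.lt_succ_self))

theorem steps_set (v : Reg) (e : Expr) : (Stmt.set v e).steps σ = e.cost + 1 := rfl

@[simp] theorem steps_block_nil : (block []).steps σ = 1 := rfl

@[simp] theorem steps_block_cons (P : Stmt) (Ps : List Stmt) :
    (block (P :: Ps)).steps σ = P.steps σ + (block Ps).steps (P.run σ) := rfl

theorem steps_loop_le {v : Reg} {e : Expr} {body : Stmt} {c : ℕ} (h : ∀ τ, body.steps τ ≤ c) :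
    (Stmt.loop v e body).steps σ ≤ e.eval σ * (c + 1) + (e.cost + 1) := by
  simp only [Stmt.steps, Stmt.exec] at *
  generalize e.cost + 1 = d
  generalize e.eval σ = N
  induction N with
  | zero => simp
  | succ N ih =>
    rw [List.range_succ, List.foldl_append, List.foldl_cons, List.foldl_nil]
    dsimp only
    refine (Nat.add_le_add_right (Nat.add_le_add ih (h _)) 1).trans (le_of_eq ?_)
    ring

end Run

@[simp] theorem setReg_arr (σ : State) (v : Reg) (m : ℕ) : (σ.setReg v m).arr = σ.arr := rfl

@[simp] theorem setReg_out (σ : State) (v : Reg) (m : ℕ) : (σ.setReg v m).out = σ.out := rfl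

@[simp] theorem setArr_reg (σ : State) (A : Arr) (j m : ℕ) : (σ.setArr A j m).reg = σ.reg := rfl

theorem setReg_reg (σ : State) (v w : Reg) (m : ℕ) :
    (σ.setReg v m).reg w = if w = v then m else σ.reg w := by
  simp [State.setReg, Function.update_apply]

@[simp] theorem setReg_reg_self (σ : State) (v : Reg) (m : ℕ) : (σ.setReg v m).reg v = m := by
  simp [setReg_reg]

theorem setArr_arr (σ : State) (A A' : Arr) (j j' m : ℕ) :
    (σ.setArr A j m).arr A' j' = if A' = A ∧ j' = j then m else σ.arr A' j' := by
  by_cases h : A' = A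
  · subst h; simp [State.setArr, Function.update_apply]
  · simp [State.setArr, h]

section Eval

variable (σ : State)

@[simp] theorem eval_zero : (0 : Expr).eval σ = 0 := rfl
@[simp] theorem eval_one : (1 : Expr).eval σ = 1 := rfl
@[simp] theorem eval_three : (3 : Expr).eval σ = 3 := rfl
@[simp] theorem eval_reg (v : Reg) : (Expr.reg v).eval σ = σ.reg v := rfl
@[simp] theorem eval_get (A : Arr) (e : Expr) : (Expr.get A e).eval σ = σ.arr A (e.eval σ) := rfl
@[simp] theorem eval_add (e f : Expr) : (e + f).eval σ = e.eval σ + f.eval σ := rfl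
@[simp] theorem eval_sub (e f : Expr) : (e - f).eval σ = e.eval σ - f.eval σ := rfl

@[simp] theorem test_lt (e f : Expr) : (Test.lt e f).eval σ = true ↔ e.eval σ < f.eval σ := by
  simp [Test.eval]

@[simp] theorem test_eq (e f : Expr) : (Test.eq e f).eval σ = true ↔ e.eval σ = f.eval σ := by
  simp [Test.eval]

@[simp] theorem test_not (t : Test) : (Test.not t).eval σ = true ↔ ¬ t.eval σ = true := by
  simp [Test.eval]

@[simp] theorem test_and (t u : Test) :
    (Test.and t u).eval σ = true ↔ t.eval σ = true ∧ u.eval σ = true := by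
  simp [Test.eval]

end Eval

/-! ### What a program can modify -/

/-- The registers a program may write to. -/
def Stmt.writes : Stmt → Reg → Bool
  | .skip, _ => false
  | .set v _, w => decide (w = v)
  | .put _ _ _, _ => false
  | .emit _ _, _ => false
  | .seq P Q, w => P.writes w || Q.writes w
  | .cond _ P Q, w => P.writes w || Q.writes w
  | .loop v _ body, w => decide (w = v) || body.writes w

/-- The arrays a program may write to. -/
def Stmt.puts : Stmt → Arr → Bool
  | .skip, _ => false
  | .set _ _, _ => false
  | .put A _ _, A' => decide (A' = A)
  | .emit _ _, _ => false
  | .seq P Q, A => P.puts A || Q.puts A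
  | .cond _ P Q, A => P.puts A || Q.puts A
  | .loop _ _ body, A => body.puts A

/-- Whether a program may output something. -/
def Stmt.emits : Stmt → Bool
  | .skip => false
  | .set _ _ => false
  | .put _ _ _ => false
  | .emit _ _ => true
  | .seq P Q => P.emits || Q.emits
  | .cond _ P Q => P.emits || Q.emits
  | .loop _ _ body => body.emits

/-- A frame rule: the hypothesis is a computation on the syntax, so for a concrete program and
register it is closed by `rfl`. The next two lemmas do the same for arrays and output. -/
theorem run_reg_of_writes {P : Stmt} {w : Reg} (h : P.writes w = false) (σ : State) :
    (P.run σ).reg w = σ.reg w := by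
  induction P generalizing σ with
  | skip => rfl
  | set v e => simp only [Stmt.writes, decide_eq_false_iff_not] at h; simp [setReg_reg, h]
  | put A e f => rfl
  | emit m e => rfl
  | seq P Q ihP ihQ =>
    simp only [Stmt.writes, Bool.or_eq_false_iff] at h
    rw [run_seq, ihQ h.2, ihP h.1]
  | cond t P Q ihP ihQ =>
    simp only [Stmt.writes, Bool.or_eq_false_iff] at h
    rw [run_cond]
    split_ifs
    · exact ihP h.1 σ
    · exact ihQ h.2 σ
  | loop v e body ih =>
    simp only [Stmt.writes, Bool.or_eq_false_iff, decide_eq_false_iff_not] at h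
    refine run_loop_induction (fun _ τ => τ.reg w = σ.reg w) rfl fun j _ τ hτ => ?_
    rw [ih h.2, setReg_reg, if_neg h.1, hτ]

theorem run_arr_of_puts {P : Stmt} {A : Arr} (h : P.puts A = false) (σ : State) :
    (P.run σ).arr A = σ.arr A := by
  induction P generalizing σ with
  | skip => rfl
  | set v e => rfl
  | put A' e f =>
    simp only [Stmt.puts, decide_eq_false_iff_not] at h
    funext j
    simp [setArr_arr, h]
  | emit m e => rfl
  | seq P Q ihP ihQ =>
    simp only [Stmt.puts, Bool.or_eq_false_iff] at h
    rw [run_seq, ihQ h.2, ihP h.1]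
  | cond t P Q ihP ihQ =>
    simp only [Stmt.puts, Bool.or_eq_false_iff] at h
    rw [run_cond]
    split_ifs
    · exact ihP h.1 σ
    · exact ihQ h.2 σ
  | loop v e body ih =>
    refine run_loop_induction (fun _ τ => τ.arr A = σ.arr A) rfl fun j _ τ hτ => ?_
    rw [ih h, setReg_arr, hτ]

theorem run_out_of_emits {P : Stmt} (h : P.emits = false) (σ : State) :
    (P.run σ).out = σ.out := by
  induction P generalizing σ with
  | skip => rfl
  | set v e => rfl
  | put A' e f => rfl
  | emit m e => simp [Stmt.emits] at h
  | seq P Q ihP ihQ =>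
    simp only [Stmt.emits, Bool.or_eq_false_iff] at h
    rw [run_seq, ihQ h.2, ihP h.1]
  | cond t P Q ihP ihQ =>
    simp only [Stmt.emits, Bool.or_eq_false_iff] at h
    rw [run_cond]
    split_ifs
    · exact ihP h.1 σ
    · exact ihQ h.2 σ
  | loop v e body ih =>
    refine run_loop_induction (fun _ τ => τ.out = σ.out) rfl fun j _ τ hτ => ?_
    rw [ih h, setReg_out, hτ]

/-! ### Running times of programs without loops -/

/-- Programs without loops. -/
def Stmt.loopFree : Stmt → Bool
  | .seq P Q => P.loopFree && Q.loopFree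
  | .cond _ P Q => P.loopFree && Q.loopFree
  | .loop _ _ _ => false
  | _ => true

/-- A bound on the running time of a program without loops. -/
def Stmt.size : Stmt → ℕ
  | .skip => 1
  | .set _ e => e.cost + 1
  | .put _ e f => e.cost + f.cost + 1
  | .emit _ e => e.cost + 1
  | .seq P Q => P.size + Q.size
  | .cond t P Q => t.cost + (P.size + Q.size) + 1
  | .loop _ _ _ => 0

/-- `size` charges both branches of a conditional, which makes the bound independent of the state.
Only loops can therefore contribute a multiple of `k`. -/
theorem steps_le_size {P : Stmt} (h : P.loopFree = true) (σ : State) : P.steps σ ≤ P.size := by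
  induction P generalizing σ with
  | skip => exact le_rfl
  | set v e => exact le_rfl
  | put A e f => exact le_rfl
  | emit m e => exact le_rfl
  | seq P Q ihP ihQ =>
    simp only [Stmt.loopFree, Bool.and_eq_true] at h
    exact Nat.add_le_add (ihP h.1 σ) (ihQ h.2 _)
  | cond t P Q ihP ihQ =>
    simp only [Stmt.loopFree, Bool.and_eq_true] at h
    have hP := ihP h.1 σ
    have hQ := ihQ h.2 σ
    simp only [Stmt.steps, Stmt.exec, Stmt.size] at *
    split_ifs <;> omega
  | loop v e body ih => simp [Stmt.loopFree] at h

/-! ### Columns on the universal cover of the cycle -/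

/-- The column at signed distance `e` from column `c`. -/
def shift {k : ℕ} (c : Fin k) (e : ℤ) : Fin k :=
  ⟨((c + e) % k).toNat, by
    have hk : (0 : ℤ) < k := by exact_mod_cast c.pos
    have := Int.emod_lt_of_pos (c + e) hk
    have := Int.emod_nonneg (c + e) hk.ne'
    omega⟩

section Shift

variable {k : ℕ} (c : Fin k)

theorem shift_val (e : ℤ) : ((shift c e).val : ℤ) = (c + e) % k := by
  have hk : (0 : ℤ) < k := by exact_mod_cast c.pos
  exact Int.toNat_of_nonneg (Int.emod_nonneg _ hk.ne')

/-- Turns questions about columns on the cycle into divisibility questions about their lifts. -/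
theorem shift_eq_shift_iff {e f : ℤ} : shift c e = shift c f ↔ (k : ℤ) ∣ e - f := by
  rw [Fin.ext_iff, ← Int.natCast_inj, shift_val, shift_val,
    Int.emod_eq_emod_iff_emod_sub_eq_zero, ← Int.dvd_iff_emod_eq_zero, add_sub_add_left_eq_sub]

theorem shift_zero : shift c 0 = c := by
  rw [Fin.ext_iff, ← Int.natCast_inj, shift_val, add_zero]
  exact Int.emod_eq_of_lt (by positivity) (by exact_mod_cast c.2)

theorem next_shift (e : ℤ) : next (shift c e) = shift c (e + 1) := by
  rw [Fin.ext_iff, ← Int.natCast_inj, shift_val, next]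
  push_cast
  rw [shift_val, Int.emod_add_emod, add_assoc]

theorem prev_shift (e : ℤ) : prev (shift c e) = shift c (e - 1) := by
  have hk := c.pos
  rw [Fin.ext_iff, ← Int.natCast_inj, shift_val, prev]
  push_cast [Nat.cast_sub hk]
  rw [shift_val, Int.emod_add_emod,
    show (c : ℤ) + e + (k - 1) = c + (e - 1) + k by ring, Int.add_emod_right]

theorem shift_sub_period (e : ℤ) : shift c (e - k) = shift c e :=
  (shift_eq_shift_iff c).2 ⟨-1, by ring⟩

/-- Every column is at a distance in `{0, …, k - 1}` from `c`. -/
theorem exists_shift_eq (i : Fin k) : ∃ j < k, shift c (j : ℕ) = i := by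
  have hk : (0 : ℤ) < k := by exact_mod_cast c.pos
  have h1 := Int.emod_lt_of_pos ((i : ℤ) - c) hk
  have h2 := Int.emod_nonneg ((i : ℤ) - c) hk.ne'
  refine ⟨(((i : ℤ) - c) % k).toNat, by omega, ?_⟩
  rw [Fin.ext_iff, ← Int.natCast_inj, shift_val, Int.toNat_of_nonneg h2, Int.add_emod_emod,
    add_sub_cancel]
  exact Int.emod_eq_of_lt (by positivity) (by exact_mod_cast i.2)

/-- Lifts less than one full turn apart stay distinct modulo `k`. This is what guarantees that a
static step alters a bit not covered before. -/
theorem shift_ne_shift {e f : ℤ} (h : e < f) (h' : f < e + k) : shift c e ≠ shift c f := by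
  rw [Ne, shift_eq_shift_iff, ← dvd_neg, neg_sub]
  intro hd
  have := Int.le_of_dvd (by omega) hd
  omega

end Shift

theorem prev_next {k : ℕ} (c : Fin k) : prev (next c) = c := by
  have h : next c = shift c (0 + 1) := by rw [← next_shift, shift_zero]
  rw [h, prev_shift, show (0 + 1 - 1 : ℤ) = 0 by norm_num, shift_zero]

/-! ### Lower bound on the length of a walk -/

/-- On the universal cover, a walk of length `ℓ` with steps of the four types that starts at `0`
ends at `f`, spans the positions from `m` to `M`, and may in addition have covered the position
above `M` (if `α = 1`) and the one below `m` (if `β = 1`) by static steps. -/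
structure Span {n k : ℕ} (src v : Server n k) (ℓ : ℕ) (m M f α β : ℤ) : Prop where
  m_nonpos : m ≤ 0
  M_nonneg : 0 ≤ M
  m_le : m ≤ f
  le_M : f ≤ M
  α_mem : 0 ≤ α ∧ α ≤ 1
  β_mem : 0 ≤ β ∧ β ≤ 1
  length : 2 * (M - m) - |f| + α + β ≤ ℓ
  col : v.col = shift src.col f
  row : ∀ i, src.row i ≠ v.row i → ∃ e, m - β ≤ e ∧ e < M + α ∧ shift src.col e = i

/-- Two adjacent servers have their columns at the ends of an edge of the cycle of columns, and
differ at most in the bit belonging to that edge. -/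
theorem exists_shift_of_adj {n k : ℕ} {u v : Server n k} (c : Fin k) (f : ℤ)
    (hu : u.col = shift c f) (h : (graph n k).Adj u v) :
    ∃ f' e : ℤ, v.col = shift c f' ∧ (f = e ∨ f = e + 1) ∧ (f' = e ∨ f' = e + 1) ∧
      ∀ i, i ≠ shift c e → u.row i = v.row i := by
  obtain ⟨-, w, ⟨hu', huw⟩, hv', hvw⟩ := h
  have key : ∀ e, w.col = shift c e → ∀ i, i ≠ shift c e → u.row i = v.row i := by
    intro e he i hi
    rw [← he] at hi
    rw [← huw ⟨i, hi⟩, hvw ⟨i, hi⟩]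
  -- The column of the common switch lifts to `f` or to `f - 1`, according to which side of the
  -- switch `u` is on; `v` may then be on either side.
  rcases hu' with hu' | hu'
  · have hw : w.col = shift c f := hu' ▸ hu
    rcases hv' with hv' | hv'
    · exact ⟨f, f, hv'.trans hw, .inl rfl, .inl rfl, key f hw⟩
    · exact ⟨f + 1, f, by rw [hv', hw, next_shift], .inl rfl, .inr rfl, key f hw⟩
  · have hw : w.col = shift c (f - 1) := by
      rw [← prev_shift, ← hu, hu', prev_next]
    rcases hv' with hv' | hv'
    · exact ⟨f - 1, f - 1, hv'.trans hw, .inr (by ring), .inl rfl, key _ hw⟩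
    · exact ⟨f, f - 1, by rw [hv', ← hu', hu], .inr (by ring), .inr (by ring), key _ hw⟩

/-- Only a step on the edge just outside `[m, M]` enlarges the covered set. Done statically it
raises `α` or `β` to `1`; done by crossing it raises `M - m` by one, while `|f|` grows by one and
the static bonus is reset. Inside the range, `|f|` falls by at most one. The left side of the length
bound never grows by more than one. -/
theorem Span.step {n k : ℕ} {src u v : Server n k} {ℓ : ℕ} {m M f α β : ℤ}
    (h : Span src u ℓ m M f α β) (huv : (graph n k).Adj u v) :
    ∃ m' M' f' α' β', Span src v (ℓ + 1) m' M' f' α' β' := by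
  obtain ⟨f', e, hf', hfe, hfe', hrow⟩ := exists_shift_of_adj src.col f h.col huv
  obtain ⟨h1, h2, h3, h4, h5, h6, h7, h8, h9⟩ := h
  -- The rows are settled here: any bit other than that of `e` was altered earlier. What remains is
  -- integer arithmetic.
  suffices H : ∃ m' M' α' β' : ℤ, m' ≤ 0 ∧ 0 ≤ M' ∧ m' ≤ f' ∧ f' ≤ M' ∧ (0 ≤ α' ∧ α' ≤ 1) ∧
      (0 ≤ β' ∧ β' ≤ 1) ∧ 2 * (M' - m') - |f'| + α' + β' ≤ ℓ + 1 ∧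
      m' - β' ≤ m - β ∧ M + α ≤ M' + α' ∧ m' - β' ≤ e ∧ e < M' + α' by
    obtain ⟨m', M', α', β', g1, g2, g3, g4, g5, g6, g7, g8, g9, g10, g11⟩ := H
    refine ⟨m', M', f', α', β', g1, g2, g3, g4, g5, g6, by exact_mod_cast g7, hf', ?_⟩
    intro i hi
    by_cases hie : i = shift src.col e
    · exact ⟨e, g10, g11, hie.symm⟩
    · rw [← hrow i hie] at hi
      obtain ⟨z, hz1, hz2, hz3⟩ := h9 i hi
      exact ⟨z, by omega, by omega, hz3⟩
  have habs : |f| = max f (-f) := abs_eq_max_neg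
  have habs' : |f'| = max f' (-f') := abs_eq_max_neg
  -- The edge lies just above the range, just below it, or inside it.
  by_cases hM : e = M
  · by_cases hf : f' = f
    · exact ⟨m, M, 1, β, by omega⟩
    · exact ⟨m, M + 1, 0, β, by omega⟩
  · by_cases hm : e = m - 1
    · by_cases hf : f' = f
      · exact ⟨m, M, α, 1, by omega⟩
      · exact ⟨m - 1, M, α, 0, by omega⟩
    · exact ⟨m, M, α, β, by omega⟩

theorem Span.walk {n k : ℕ} {src u v : Server n k} (q : (graph n k).Walk u v) {ℓ : ℕ}
    {m M f α β : ℤ} (h : Span src u ℓ m M f α β) :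
    ∃ m' M' f' α' β', Span src v (ℓ + q.length) m' M' f' α' β' := by
  induction q generalizing ℓ m M f α β with
  | nil => exact ⟨m, M, f, α, β, h⟩
  | cons huv q ih =>
    obtain ⟨m', M', f', α', β', h'⟩ := h.step huv
    rw [SimpleGraph.Walk.length_cons, add_comm q.length, ← add_assoc]
    exact ih h'

/-- The walk is extended step by step from the one-point span at `0`, which has covered nothing. -/
theorem exists_span {n k : ℕ} {src dst : Server n k} (q : (graph n k).Walk src dst) :
    ∃ m M f α β, Span src dst q.length m M f α β := by
  have h : Span src src 0 0 0 0 0 0 :=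
    ⟨le_rfl, le_rfl, le_rfl, le_rfl, by simp, by simp, by simp, (shift_zero _).symm, by simp⟩
  simpa using h.walk q

/-! ### Routes that set bits to their values in the destination -/

open Classical in
/-- The server at signed distance `f` from the column of `src` whose bits in the columns at
distance `lo, …, hi - 1` are those of `dst` and whose other bits are those of `src`. -/
noncomputable def blend {n k : ℕ} (src dst : Server n k) (f lo hi : ℤ) : Server n k where
  col := shift src.col f
  row i := if ∃ e, lo ≤ e ∧ e < hi ∧ shift src.col e = i then dst.row i else src.row i

/-- The bit at signed distance `e` from the column of `src` has to be changed. -/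
def Marked {n k : ℕ} (src dst : Server n k) (e : ℤ) : Prop :=
  src.row (shift src.col e) ≠ dst.row (shift src.col e)

/-- The list of hops describes a walk from `src` to `blend src dst f lo hi`. -/
def Route {n k : ℕ} (src dst : Server n k) (hs : List Hop) (f lo hi : ℤ) : Prop :=
  lo ≤ f ∧ f ≤ hi ∧ ∃ p : (graph n k).Walk src (blend src dst f lo hi),
    Describes hs p ∧ p.length = hs.length

theorem Describes.concat {n k : ℕ} {u v w : Server n k} {hs : List Hop}
    {p : (graph n k).Walk u v} (hp : Describes hs p) {h : Hop} (hvw : (graph n k).Adj v w)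
    (hh : h.Leads v w) : Describes (hs ++ [h]) (p.concat hvw) := by
  induction p generalizing hs with
  | nil =>
    cases hs with
    | nil => exact ⟨hh, trivial⟩
    | cons _ _ => exact hp.elim
  | cons h' p ih =>
    cases hs with
    | nil => exact hp.elim
    | cons g hs => exact ⟨hp.1, ih hp.2 hvw hh⟩

section Route

variable {n k : ℕ} {src dst : Server n k} {hs : List Hop} {f lo hi : ℤ}

theorem marked_sub_period {e : ℤ} : Marked src dst (e - k) ↔ Marked src dst e := by
  rw [Marked, Marked, shift_sub_period]

theorem blend_zero : blend src dst 0 0 0 = src := by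
  ext i
  · simp [blend, shift_zero]
  · have : ¬ ∃ e : ℤ, 0 ≤ e ∧ e < 0 ∧ shift src.col e = i := by
      rintro ⟨e, h1, h2, -⟩
      omega
    simp [blend, this]

theorem route_nil : Route src dst [] 0 0 0 := by
  refine ⟨le_rfl, le_rfl, ?_⟩
  rw [blend_zero]
  exact ⟨.nil, trivial, rfl⟩

/-- The common extension step for all four moves: `e` is the lift of the edge used, and `hcov` says
that the window grows by `e` at most. `hne` is a separate hypothesis because adjacency demands
distinct servers, for a reason that depends on the move. -/
theorem Route.snoc (h : Route src dst hs f lo hi) (mv : Move) (f' lo' hi' e : ℤ)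
    (htarget : mv.target (shift src.col f) = shift src.col f')
    (hcovers : mv.covers (shift src.col f) = shift src.col e)
    (hf : f = e ∨ f = e + 1) (hf' : f' = e ∨ f' = e + 1)
    (hlo : lo' ≤ f') (hhi : f' ≤ hi')
    (hcov : ∀ z, (lo' ≤ z ∧ z < hi') ↔ (lo ≤ z ∧ z < hi) ∨ z = e)
    (hne : blend src dst f lo hi ≠ blend src dst f' lo' hi') :
    Route src dst (hs ++ [⟨mv, dst.row (shift src.col e)⟩]) f' lo' hi' := by
  obtain ⟨-, -, p, hp, hlen⟩ := h
  have hrow : ∀ i, i ≠ shift src.col e →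
      (blend src dst f' lo' hi').row i = (blend src dst f lo hi).row i := by
    intro i hi
    simp only [blend]
    congr 1
    refine propext (exists_congr fun z => ?_)
    rw [← and_assoc, ← and_assoc, hcov]
    constructor
    · rintro ⟨hz | rfl, hz'⟩
      · exact ⟨hz, hz'⟩
      · exact absurd hz'.symm hi
    · rintro ⟨hz, hz'⟩
      exact ⟨.inl hz, hz'⟩
  have hcol : ∀ g : ℤ, g = e ∨ g = e + 1 →
      shift src.col g = shift src.col e ∨ shift src.col g = next (shift src.col e) := by
    rintro g (rfl | rfl)
    · exact .inl rfl
    · exact .inr (next_shift _ _).symm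
  -- The common switch lies at `e`, and its name is the row shared by both servers outside that bit.
  have hadj : (graph n k).Adj (blend src dst f lo hi) (blend src dst f' lo' hi') :=
    ⟨hne, ⟨shift src.col e, fun i => (blend src dst f lo hi).row i⟩,
      ⟨hcol f hf, fun _ => rfl⟩, hcol f' hf', fun i => (hrow i i.2).symm⟩
  refine ⟨hlo, hhi, p.concat hadj, hp.concat hadj ⟨htarget.symm, ?_, ?_⟩, ?_⟩
  · show ((blend src dst f' lo' hi').row (mv.covers (shift src.col f))).val = _
    have : ∃ z, lo' ≤ z ∧ z < hi' ∧ shift src.col z = shift src.col e :=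
      ⟨e, ((hcov e).2 (.inr rfl)).1, ((hcov e).2 (.inr rfl)).2, rfl⟩
    rw [hcovers]
    simp [blend, this]
  · intro i hi
    refine hrow i ?_
    rw [← hcovers]
    exact hi
  · simp [hlen]

theorem blend_ne_of_col (hk : 2 ≤ k) {f' lo' hi' : ℤ} (h : f' = f + 1 ∨ f' = f - 1) :
    blend src dst f lo hi ≠ blend src dst f' lo' hi' := by
  intro heq
  have hc : shift src.col f = shift src.col f' := congrArg Server.col heq
  rcases h with rfl | rfl
  · exact shift_ne_shift _ (by omega) (by omega) hc
  · exact shift_ne_shift _ (by omega) (by omega) hc.symm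

/-- A marked bit that was outside the window modulo `k` passes from its source value to its
different destination value. -/
theorem blend_ne_of_row {f' lo' hi' e : ℤ} (he : Marked src dst e)
    (h : ∀ z, lo ≤ z → z < hi → shift src.col z ≠ shift src.col e) (hlo : lo' ≤ e) (hhi : e < hi') :
    blend src dst f lo hi ≠ blend src dst f' lo' hi' := by
  intro heq
  have hr := congrFun (congrArg Server.row heq) (shift src.col e)
  have h1 : ∃ z, lo' ≤ z ∧ z < hi' ∧ shift src.col z = shift src.col e := ⟨e, hlo, hhi, rfl⟩
  have h2 : ¬ ∃ z, lo ≤ z ∧ z < hi ∧ shift src.col z = shift src.col e :=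
    fun ⟨z, hz1, hz2, hz3⟩ => h z hz1 hz2 hz3
  simp only [blend, h1, h2, if_true, if_false] at hr
  exact he hr

theorem Route.clockwise (hk : 2 ≤ k) (h : Route src dst hs f lo hi) :
    Route src dst (hs ++ [⟨.c, dst.row (shift src.col f)⟩]) (f + 1) lo (max hi (f + 1)) :=
  have h1 := h.1
  have h2 := h.2.1
  h.snoc .c _ _ _ f (next_shift _ _) rfl (.inl rfl) (.inr rfl) (by omega) (by omega)
    (fun z => by omega) (blend_ne_of_col hk (.inl rfl))

theorem Route.anticlockwise (hk : 2 ≤ k) (h : Route src dst hs f lo hi) :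
    Route src dst (hs ++ [⟨.a, dst.row (shift src.col (f - 1))⟩]) (f - 1) (min lo (f - 1)) hi :=
  have h1 := h.1
  have h2 := h.2.1
  h.snoc .a _ _ _ (f - 1) (prev_shift _ _) (prev_shift _ _) (.inr (by ring)) (.inl rfl)
    (by omega) (by omega) (fun z => by omega) (blend_ne_of_col hk (.inr rfl))

/-- The position is at the upper end of a window shorter than `k`, so the bit at `f` has no
representative in the window and still has its source value. The decremented version is the mirror
image at the lower end. -/
theorem Route.basicStatic (h : Route src dst hs f lo hi) (hf : f = hi) (hk : f < lo + k)
    (hm : Marked src dst f) :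
    Route src dst (hs ++ [⟨.b, dst.row (shift src.col f)⟩]) f lo (f + 1) :=
  have h1 := h.1
  h.snoc .b _ _ _ f rfl rfl (.inl rfl) (.inl rfl) (by omega) (by omega)
    (fun z => by omega) (blend_ne_of_row hm (fun _ _ _ => shift_ne_shift _ (by omega) (by omega))
      (by omega) (by omega))

theorem Route.decrementedStatic (h : Route src dst hs f lo hi) (hf : f = lo) (hk : hi < lo + k)
    (hm : Marked src dst (f - 1)) :
    Route src dst (hs ++ [⟨.d, dst.row (shift src.col (f - 1))⟩]) f (f - 1) hi :=
  have h2 := h.2.1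
  h.snoc .d _ _ _ (f - 1) rfl (prev_shift _ _) (.inr (by ring)) (.inr (by ring)) (by omega)
    (by omega) (fun z => by omega) (blend_ne_of_row hm
      (fun _ _ _ => (shift_ne_shift _ (by omega) (by omega)).symm) (by omega) (by omega))

/-- A route that has covered all marked positions and arrived at the column of `dst` leads to
`dst`. -/
theorem blend_eq_dst (hcol : shift src.col f = dst.col)
    (hcov : ∀ j : ℕ, j < k → Marked src dst j →
      (lo ≤ j ∧ j < hi) ∨ (lo ≤ (j : ℤ) - k ∧ (j : ℤ) - k < hi)) :
    blend src dst f lo hi = dst := by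
  ext i
  · simp [blend, hcol]
  · obtain ⟨j, hj, rfl⟩ := exists_shift_eq src.col i
    simp only [blend]
    split_ifs with h
    · rfl
    · by_contra hne
      refine h ?_
      rcases hcov j hj (fun heq => hne (congrArg Fin.val heq)) with hc | hc
      · exact ⟨j, hc.1, hc.2, rfl⟩
      · exact ⟨j - k, hc.1, hc.2, shift_sub_period _ _⟩

end Route

/-! ### Calculation of the marked nodes -/

/-- What is known after the calculation of `x`, `B` and the target values of the bits. -/
structure Prepared {n k : ℕ} (src dst : Server n k) (σ : State) : Prop where
  reg_k : σ.reg .k = k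
  x_lt : σ.reg .x < k
  shift_x : shift src.col (σ.reg .x) = dst.col
  B_le : ∀ j, j < k → σ.arr .B j ≤ 1
  B_eq : ∀ j, j < k → (σ.arr .B j = 1 ↔ Marked src dst j)
  fix_eq : ∀ j, j < k → σ.arr .fix j = dst.row (shift src.col j)
  out_nil : σ.out = []

theorem next_val {k : ℕ} (c : Fin k) : (next c).val = if c.val + 1 = k then 0 else c.val + 1 := by
  have := c.2
  simp only [next]
  split_ifs with h
  · rw [h, Nat.mod_self]
  · exact Nat.mod_eq_of_lt (by omega)

/-- One round of the calculation of the marked nodes. -/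
def markRound : Stmt := block [
  .cond (.eq (.get .src Reg.p) (.get .dst Reg.p)) (.put .B Reg.i 0) (.put .B Reg.i 1),
  .put .fix Reg.i (.get .dst Reg.p),
  .set .p (Reg.p + 1 : Expr),
  DPillar.when (.eq Reg.p Reg.k) (.set .p 0)]

section MarkRound

variable (τ : State)

theorem markRound_p :
    (markRound.run τ).reg .p = if τ.reg .p + 1 = τ.reg .k then 0 else τ.reg .p + 1 := by
  obtain ⟨υ, hυ⟩ : ∃ υ, υ = (Stmt.put .fix Reg.i (.get .dst Reg.p)).run
    ((Stmt.cond (.eq (.get .src Reg.p) (.get .dst Reg.p)) (.put .B Reg.i 0)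
      (.put .B Reg.i 1)).run τ) := ⟨_, rfl⟩
  have hp : υ.reg .p = τ.reg .p := by rw [hυ, run_reg_of_writes rfl, run_reg_of_writes rfl]
  have hk : υ.reg .k = τ.reg .k := by rw [hυ, run_reg_of_writes rfl, run_reg_of_writes rfl]
  rw [← hp, ← hk, markRound, run_block_cons, run_block_cons, ← hυ]
  simp only [run_block_cons, run_block_nil, run_when, run_set, test_eq, eval_reg, eval_add,
    eval_one, eval_zero, setReg_reg, if_true, reduceCtorEq, if_false]
  split_ifs <;> simp

theorem markRound_B (j : ℕ) :
    (markRound.run τ).arr .B j = if j = τ.reg .i then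
      (if τ.arr .src (τ.reg .p) = τ.arr .dst (τ.reg .p) then 0 else 1) else τ.arr .B j := by
  rw [markRound, run_block_cons, run_block_cons, run_arr_of_puts rfl, run_arr_of_puts rfl, run_cond]
  simp only [test_eq, eval_get, eval_reg, run_put, eval_zero, eval_one]
  by_cases h1 : τ.arr .src (τ.reg .p) = τ.arr .dst (τ.reg .p) <;> simp [h1, setArr_arr]

theorem markRound_fix (j : ℕ) :
    (markRound.run τ).arr .fix j =
      if j = τ.reg .i then τ.arr .dst (τ.reg .p) else τ.arr .fix j := by
  rw [markRound, run_block_cons, run_block_cons, run_arr_of_puts rfl, run_put, setArr_arr, eval_get,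
    eval_reg, eval_reg, run_reg_of_writes rfl, run_reg_of_writes rfl, run_arr_of_puts rfl,
    run_arr_of_puts rfl]
  simp

end MarkRound

theorem calcB_prepared {n k : ℕ} (src dst : Server n k) :
    Prepared src dst (calcB.run (load src dst)) := by
  have hsrc := src.col.2
  have hdst := dst.col.2
  obtain ⟨σ, hσ⟩ : ∃ σ, σ = (Stmt.set .p (Reg.srcCol : Expr)).run
    ((Stmt.cond (.lt Reg.dstCol Reg.srcCol)
      (.set .x (Reg.dstCol + Reg.k - Reg.srcCol : Expr))
      (.set .x (Reg.dstCol - Reg.srcCol : Expr))).run (load src dst)) := ⟨_, rfl⟩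
  have hk : σ.reg .k = k := by
    rw [hσ, run_reg_of_writes rfl, run_reg_of_writes rfl]
    rfl
  have hp : σ.reg .p = src.col.val := by
    rw [hσ, run_set, setReg_reg_self, eval_reg, run_reg_of_writes rfl]
    rfl
  have hsrc' : ∀ c : Fin k, σ.arr .src c.val = src.row c := by
    intro c
    rw [hσ, run_arr_of_puts rfl, run_arr_of_puts rfl]
    simp [load]
  have hdst' : ∀ c : Fin k, σ.arr .dst c.val = dst.row c := by
    intro c
    rw [hσ, run_arr_of_puts rfl, run_arr_of_puts rfl]
    simp [load]
  have hx : σ.reg .x = if dst.col.val < src.col.val then dst.col.val + k - src.col.val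
      else dst.col.val - src.col.val := by
    rw [hσ, run_reg_of_writes rfl, run_cond]
    simp only [test_lt, eval_reg, load, run_set]
    split_ifs <;> simp
  -- The register `p` runs through the actual columns while `N` counts distances from the source;
  -- the reset of `p` at `k` is the wrap-around in `next_val`.
  have main := run_loop_induction (σ := σ) (v := .i) (e := (Reg.k : Expr)) (body := markRound)
    (fun N τ => τ.reg .k = k ∧ τ.reg .p = (shift src.col N).val ∧ τ.arr .src = σ.arr .src ∧
      τ.arr .dst = σ.arr .dst ∧ ∀ j < N, τ.arr .B j ≤ 1 ∧ (τ.arr .B j = 1 ↔ Marked src dst j) ∧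
        τ.arr .fix j = dst.row (shift src.col j)) ?_ ?_
  · have hrun : calcB.run (load src dst) = (Stmt.loop .i (Reg.k : Expr) markRound).run σ := by rw [hσ]; rfl
    rw [hrun]
    rw [eval_reg, hk] at main
    obtain ⟨h1, -, -, -, h2⟩ := main
    have hx' := run_reg_of_writes (P := Stmt.loop .i (Reg.k : Expr) markRound) (w := .x) rfl σ
    refine ⟨h1, ?_, ?_, fun j hj => (h2 j hj).1, fun j hj => (h2 j hj).2.1,
      fun j hj => (h2 j hj).2.2, ?_⟩
    · rw [hx', hx]
      split_ifs <;> omega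
    · rw [hx', hx, Fin.ext_iff, ← Int.natCast_inj, shift_val]
      split_ifs with hlt
      -- The program adds `k` before subtracting, which avoids truncation and gives the residue of
      -- the column difference.
      · rw [show ((src.col.val : ℕ) : ℤ) + ((dst.col.val + k - src.col.val : ℕ) : ℤ)
          = dst.col.val + k by omega, Int.add_emod_right]
        exact Int.emod_eq_of_lt (by positivity) (by exact_mod_cast hdst)
      · rw [show ((src.col.val : ℕ) : ℤ) + ((dst.col.val - src.col.val : ℕ) : ℤ)
          = dst.col.val by omega]
        exact Int.emod_eq_of_lt (by positivity) (by exact_mod_cast hdst)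
    · rw [run_out_of_emits rfl, hσ, run_out_of_emits rfl, run_out_of_emits rfl]
      rfl
  · refine ⟨hk, ?_, rfl, rfl, by simp⟩
    rw [hp, Nat.cast_zero, shift_zero]
  · rintro N - τ ⟨h1, h2, h3, h4, h5⟩
    have hval := next_val (shift src.col N)
    rw [next_shift] at hval
    have e1 : τ.arr .src (τ.reg .p) = src.row (shift src.col N) := by rw [h3, h2, hsrc']
    have e2 : τ.arr .dst (τ.reg .p) = dst.row (shift src.col N) := by rw [h4, h2, hdst']
    refine ⟨by rw [run_reg_of_writes rfl]; simpa [setReg_reg] using h1, ?_,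
      by rw [run_arr_of_puts rfl]; exact h3, by rw [run_arr_of_puts rfl]; exact h4, ?_⟩
    · push_cast
      rw [hval, ← h2, markRound_p]
      simp [setReg_reg, h1]
    · intro j hj
      rw [markRound_B, markRound_fix]
      simp only [setReg_reg_self, setReg_reg, reduceCtorEq, if_false, setReg_arr, e1, e2]
      by_cases hjN : j = N
      · subst hjN
        simp only [if_true, Marked, Fin.val_inj]
        split_ifs with h <;> simp [h]
      · simp only [hjN, if_false]
        exact h5 j (by omega)

/-! ### Calculation of the parameters -/

/-- The outcome of a scan of `{0, …, N - 1}` for the elements satisfying `P`: their number, the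
first and the last one, and the ends of a largest gap between consecutive ones. -/
structure Scanned (P : ℕ → Prop) (N r first last gap lo hi : ℕ) : Prop where
  none : r = 0 → ∀ j < N, ¬ P j
  first_spec : 0 < r → first < N ∧ P first ∧ ∀ j < N, P j → first ≤ j
  last_spec : 0 < r → last < N ∧ P last ∧ ∀ j < N, P j → j ≤ last
  one : r = 1 → first = last
  gap_spec : 1 < r → P lo ∧ P hi ∧ hi = lo + gap ∧ 0 < gap ∧ hi < N ∧
    ∀ j < N, P j → j ≤ lo ∨ hi ≤ j
  gap_zero : r ≤ 1 → gap = 0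
  gap_max : ∀ u v, u < v → v < N → P u → P v → (∀ j, u < j → j < v → ¬ P j) → v ≤ u + gap

section Scanned

variable {P : ℕ → Prop} {N r first last gap lo hi : ℕ}

theorem Scanned.zero : Scanned P 0 0 first last 0 lo hi := by
  constructor <;> simp

theorem Scanned.miss (h : Scanned P N r first last gap lo hi) (hN : ¬ P N) :
    Scanned P (N + 1) r first last gap lo hi := by
  have key : ∀ j < N + 1, P j → j < N := fun j hj hP =>
    (Nat.lt_succ_iff_lt_or_eq.1 hj).resolve_right fun e => hN (e ▸ hP)
  refine ⟨fun hr j hj hP => h.none hr j (key j hj hP) hP, fun hr => ?_, fun hr => ?_, h.one,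
    fun hr => ?_, h.gap_zero, fun u v huv hv hu hPv => h.gap_max u v huv (key v hv hPv) hu hPv⟩
  · obtain ⟨h1, h2, h3⟩ := h.first_spec hr
    exact ⟨by omega, h2, fun j hj hP => h3 j (key j hj hP) hP⟩
  · obtain ⟨h1, h2, h3⟩ := h.last_spec hr
    exact ⟨by omega, h2, fun j hj hP => h3 j (key j hj hP) hP⟩
  · obtain ⟨h1, h2, h3, h4, h5, h6⟩ := h.gap_spec hr
    exact ⟨h1, h2, h3, h4, by omega, fun j hj hP => h6 j (key j hj hP) hP⟩

theorem Scanned.hit_first (h : Scanned P N r first last gap lo hi) (hN : P N) (hr : r = 0) :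
    Scanned P (N + 1) (r + 1) N N gap lo hi := by
  have key : ∀ j < N + 1, P j → j = N := fun j hj hP =>
    (Nat.lt_succ_iff_lt_or_eq.1 hj).resolve_left fun hlt => h.none hr j hlt hP
  refine ⟨by omega, fun _ => ⟨by omega, hN, fun j hj hP => (key j hj hP).ge⟩,
    fun _ => ⟨by omega, hN, fun j hj hP => (key j hj hP).le⟩, fun _ => rfl, by omega,
    fun _ => h.gap_zero (by omega), fun u v huv hv hu hPv _ => ?_⟩
  have := key v hv hPv
  have := key u (by omega) hu
  omega

/-- A new hit `N` creates just one new gap, the one from `last` to `N`. When it beats the recorded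
gap it replaces it. -/
theorem Scanned.hit_gap (h : Scanned P N r first last gap lo hi) (hN : P N) (hr : 0 < r)
    (hgap : gap < N - last) : Scanned P (N + 1) (r + 1) first N (N - last) last N := by
  obtain ⟨f1, f2, f3⟩ := h.first_spec hr
  obtain ⟨l1, l2, l3⟩ := h.last_spec hr
  have key : ∀ j < N + 1, j < N ∨ j = N := fun j hj => by omega
  refine ⟨by omega, fun _ => ⟨by omega, f2, fun j hj hP => ?_⟩,
    fun _ => ⟨by omega, hN, fun j hj hP => by omega⟩, by omega,
    fun _ => ⟨l2, hN, by omega, by omega, by omega, fun j hj hP => ?_⟩, by omega,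
    fun u v huv hv hu hPv hno => ?_⟩
  · rcases key j hj with hj | rfl
    · exact f3 j hj hP
    · omega
  · rcases key j hj with hj | rfl
    · exact .inl (l3 j hj hP)
    · exact .inr le_rfl
  · rcases key v hv with hv | rfl
    · have := h.gap_max u v huv hv hu hPv hno
      omega
    · have := l3 u huv hu
      by_contra hlt
      exact hno last (by omega) l1 l2

theorem Scanned.hit (h : Scanned P N r first last gap lo hi) (hN : P N) (hr : 0 < r)
    (hgap : ¬ gap < N - last) : Scanned P (N + 1) (r + 1) first N gap lo hi := by
  obtain ⟨f1, f2, f3⟩ := h.first_spec hr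
  obtain ⟨l1, l2, l3⟩ := h.last_spec hr
  have hr1 : 1 < r := by
    -- After a single hit the recorded gap is still `0`, and `last < N` would beat it.
    by_contra hr1
    have := h.gap_zero (by omega)
    omega
  obtain ⟨g1, g2, g3, g4, g5, g6⟩ := h.gap_spec hr1
  have key : ∀ j < N + 1, j < N ∨ j = N := fun j hj => by omega
  refine ⟨by omega, fun _ => ⟨by omega, f2, fun j hj hP => ?_⟩,
    fun _ => ⟨by omega, hN, fun j hj hP => by omega⟩, by omega,
    fun _ => ⟨g1, g2, g3, g4, by omega, fun j hj hP => ?_⟩, by omega,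
    fun u v huv hv hu hPv hno => ?_⟩
  · rcases key j hj with hj | rfl
    · exact f3 j hj hP
    · omega
  · rcases key j hj with hj | rfl
    · exact g6 j hj hP
    · omega
  · rcases key v hv with hv | rfl
    · exact h.gap_max u v huv hv hu hPv hno
    · have := l3 u huv hu
      by_contra hlt
      exact hno last (by omega) l1 l2

end Scanned

/-- What is known after the calculation of the parameters. -/
structure Measured {n k : ℕ} (src dst : Server n k) (σ : State) : Prop
    extends Prepared src dst σ where
  Δ₀_eq : σ.reg .Δ₀ = σ.arr .B 0
  Δₓ_eq : σ.reg .Δₓ = σ.arr .B (σ.reg .x)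
  above : Scanned (fun j => σ.reg .x < j ∧ j < k ∧ Marked src dst j) k
    (σ.reg .r) (σ.reg .i₁) (σ.reg .iᵣ) (σ.reg .δ) (σ.reg .δlo) (σ.reg .δhi)
  below : Scanned (fun j => 0 < j ∧ j < σ.reg .x ∧ Marked src dst j) k
    (σ.reg .s) (σ.reg .jₛ) (σ.reg .j₁) (σ.reg .ε) (σ.reg .εlo) (σ.reg .εhi)

/-- One round of the scan above `x`. -/
def scanAbove : Stmt :=
  DPillar.when (.and (.lt Reg.x Reg.i) (.eq (.get .B Reg.i) 1)) (block [
    .cond (.eq Reg.r 0)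
      (.set .i₁ Reg.i)
      (DPillar.when (.lt Reg.δ (Reg.i - Reg.iᵣ : Expr))
        (block [.set .δ (Reg.i - Reg.iᵣ : Expr), .set .δlo Reg.iᵣ, .set .δhi Reg.i])),
    .set .iᵣ Reg.i,
    .set .r (Reg.r + 1 : Expr)])

/-- One round of the scan below `x`. -/
def scanBelow : Stmt :=
  DPillar.when (.and (.and (.lt 0 Reg.i) (.lt Reg.i Reg.x)) (.eq (.get .B Reg.i) 1)) (block [
    .cond (.eq Reg.s 0)
      (.set .jₛ Reg.i)
      (DPillar.when (.lt Reg.ε (Reg.i - Reg.j₁ : Expr))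
        (block [.set .ε (Reg.i - Reg.j₁ : Expr), .set .εlo Reg.j₁, .set .εhi Reg.i])),
    .set .j₁ Reg.i,
    .set .s (Reg.s + 1 : Expr)])

theorem scanAbove_scanned {P : ℕ → Prop} {τ : State}
    (h : Scanned P (τ.reg .i) (τ.reg .r) (τ.reg .i₁) (τ.reg .iᵣ) (τ.reg .δ) (τ.reg .δlo)
      (τ.reg .δhi))
    (hP : P (τ.reg .i) ↔ τ.reg .x < τ.reg .i ∧ τ.arr .B (τ.reg .i) = 1) :
    let υ := scanAbove.run τ
    Scanned P (τ.reg .i + 1) (υ.reg .r) (υ.reg .i₁) (υ.reg .iᵣ) (υ.reg .δ) (υ.reg .δlo)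
      (υ.reg .δhi) := by
  intro υ
  by_cases hN : P (τ.reg .i)
  · have hN' := hP.1 hN
    by_cases hr : τ.reg .r = 0
    · have := h.hit_first hN hr
      simpa [υ, scanAbove, hN', hr, setReg_reg] using this
    · by_cases hgap : τ.reg .δ < τ.reg .i - τ.reg .iᵣ
      · have := h.hit_gap hN (by omega) hgap
        simpa [υ, scanAbove, hN', hr, hgap, setReg_reg] using this
      · have := h.hit hN (by omega) hgap
        simpa [υ, scanAbove, hN', hr, hgap, setReg_reg] using this
  · have := h.miss hN
    rw [hP] at hN
    simpa [υ, scanAbove, hN] using this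

theorem scanBelow_scanned {P : ℕ → Prop} {τ : State}
    (h : Scanned P (τ.reg .i) (τ.reg .s) (τ.reg .jₛ) (τ.reg .j₁) (τ.reg .ε) (τ.reg .εlo)
      (τ.reg .εhi))
    (hP : P (τ.reg .i) ↔ (0 < τ.reg .i ∧ τ.reg .i < τ.reg .x) ∧ τ.arr .B (τ.reg .i) = 1) :
    let υ := scanBelow.run τ
    Scanned P (τ.reg .i + 1) (υ.reg .s) (υ.reg .jₛ) (υ.reg .j₁) (υ.reg .ε) (υ.reg .εlo)
      (υ.reg .εhi) := by
  intro υ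
  by_cases hN : P (τ.reg .i)
  · have hN' := hP.1 hN
    by_cases hr : τ.reg .s = 0
    · have := h.hit_first hN hr
      simpa [υ, scanBelow, hN', hr, setReg_reg] using this
    · by_cases hgap : τ.reg .ε < τ.reg .i - τ.reg .j₁
      · have := h.hit_gap hN (by omega) hgap
        simpa [υ, scanBelow, hN', hr, hgap, setReg_reg] using this
      · have := h.hit hN (by omega) hgap
        simpa [υ, scanBelow, hN', hr, hgap, setReg_reg] using this
  · have := h.miss hN
    rw [hP] at hN
    simpa [υ, scanBelow, hN] using this

theorem calcParams_measured {n k : ℕ} {src dst : Server n k} {σ : State}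
    (h : Prepared src dst σ) : Measured src dst (calcParams.run σ) := by
  have hreg : ∀ {w}, calcParams.writes w = false → (calcParams.run σ).reg w = σ.reg w :=
    fun hw => run_reg_of_writes hw σ
  have harr : ∀ A, (calcParams.run σ).arr A = σ.arr A := fun A =>
    run_arr_of_puts (by cases A <;> rfl) σ
  obtain ⟨τ, hτ⟩ : ∃ τ, τ = (block [.set .Δ₀ (.get .B 0), .set .Δₓ (.get .B Reg.x),
    .set .r 0, .set .δ 0, .set .s 0, .set .ε 0]).run σ := ⟨_, rfl⟩
  have hrun : calcParams.run σ =
      (Stmt.loop .i (Reg.k : Expr) (block [scanAbove, scanBelow])).run τ := by rw [hτ]; rfl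
  have τreg : ∀ {w}, (block [.set .Δ₀ (.get .B 0), .set .Δₓ (.get .B Reg.x),
      .set .r 0, .set .δ 0, .set .s 0, .set .ε 0]).writes w = false → τ.reg w = σ.reg w :=
    fun hw => hτ ▸ run_reg_of_writes hw σ
  have τarr : τ.arr = σ.arr := by subst hτ; rfl
  have hk : τ.reg .k = k := by rw [τreg rfl, h.reg_k]
  -- Both scans share one loop. The marked set and `x` are constant throughout, so the predicates
  -- can be stated in terms of the state before the loop.
  have main := run_loop_induction (σ := τ) (v := .i) (e := (Reg.k : Expr))
    (body := block [scanAbove, scanBelow])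
    (fun N υ => υ.reg .x = σ.reg .x ∧ υ.arr .B = σ.arr .B ∧
      Scanned (fun j => σ.reg .x < j ∧ j < k ∧ Marked src dst j) N
        (υ.reg .r) (υ.reg .i₁) (υ.reg .iᵣ) (υ.reg .δ) (υ.reg .δlo) (υ.reg .δhi) ∧
      Scanned (fun j => 0 < j ∧ j < σ.reg .x ∧ Marked src dst j) N
        (υ.reg .s) (υ.reg .jₛ) (υ.reg .j₁) (υ.reg .ε) (υ.reg .εlo) (υ.reg .εhi)) ?_ ?_
  · rw [← hrun, eval_reg, hk] at main
    obtain ⟨-, -, h3, h4⟩ := main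
    refine ⟨⟨?_, ?_, ?_, ?_, ?_, ?_, ?_⟩, ?_, ?_, ?_, ?_⟩
    · rw [hreg rfl, h.reg_k]
    · rw [hreg rfl]; exact h.x_lt
    · rw [hreg rfl]; exact h.shift_x
    · rw [harr]; exact h.B_le
    · rw [harr]; exact h.B_eq
    · rw [harr]; exact h.fix_eq
    · rw [run_out_of_emits rfl, h.out_nil]
    · rw [harr, hrun, run_reg_of_writes rfl, hτ]
      simp [setReg_reg]
    · rw [harr, hreg (w := .x) rfl, hrun, run_reg_of_writes rfl, hτ]
      simp [setReg_reg]
    · rw [hreg (w := .x) rfl]; exact h3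
    · rw [hreg (w := .x) rfl]; exact h4
  · refine ⟨τreg rfl, by rw [τarr], ?_, ?_⟩
    · have h1 : τ.reg .r = 0 := by simp [hτ, setReg_reg]
      have h2 : τ.reg .δ = 0 := by simp [hτ, setReg_reg]
      rw [h1, h2]
      exact .zero
    · have h1 : τ.reg .s = 0 := by simp [hτ, setReg_reg]
      have h2 : τ.reg .ε = 0 := by simp [hτ, setReg_reg]
      rw [h1, h2]
      exact .zero
  · rintro N hN υ ⟨h1, h2, h3, h4⟩
    rw [eval_reg, hk] at hN
    have hxlt := h.x_lt
    have s1 := scanAbove_scanned (τ := υ.setReg .i N)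
      (P := fun j => σ.reg .x < j ∧ j < k ∧ Marked src dst j)
      (by simpa [setReg_reg] using h3) (by simp [setReg_reg, h1, h2, h.B_eq N hN, hN])
    have f1 : ∀ {w}, scanAbove.writes w = false →
        (scanAbove.run (υ.setReg .i N)).reg w = (υ.setReg .i N).reg w :=
      fun hw => run_reg_of_writes hw _
    have f2 : ∀ {w}, scanBelow.writes w = false →
        (scanBelow.run (scanAbove.run (υ.setReg .i N))).reg w =
          (scanAbove.run (υ.setReg .i N)).reg w :=
      fun hw => run_reg_of_writes hw _
    have fi : (scanAbove.run (υ.setReg .i N)).reg .i = N := by rw [f1 rfl]; simp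
    have fx : (scanAbove.run (υ.setReg .i N)).reg .x = σ.reg .x := by
      rw [f1 rfl]; simp [setReg_reg, h1]
    have fB : (scanAbove.run (υ.setReg .i N)).arr .B = σ.arr .B := by
      rw [run_arr_of_puts rfl]; exact h2
    -- The second scan starts from the state left by the first, which touched none of the registers
    -- that the second uses.
    have s2 := scanBelow_scanned (τ := scanAbove.run (υ.setReg .i N))
      (P := fun j => 0 < j ∧ j < σ.reg .x ∧ Marked src dst j)
      (by
        rw [fi, f1 rfl, f1 rfl, f1 rfl, f1 rfl, f1 rfl, f1 rfl]
        simpa [setReg_reg] using h4)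
      (by rw [fi, fx, fB, h.B_eq N hN, and_assoc])
    rw [fi] at s2
    refine ⟨?_, ?_, ?_, s2⟩
    · show (scanBelow.run (scanAbove.run (υ.setReg .i N))).reg .x = _
      rw [f2 rfl, fx]
    · show (scanBelow.run (scanAbove.run (υ.setReg .i N))).arr .B = _
      rw [run_arr_of_puts rfl, fB]
    · show Scanned _ _ ((scanBelow.run (scanAbove.run (υ.setReg .i N))).reg .r)
        ((scanBelow.run (scanAbove.run (υ.setReg .i N))).reg .i₁)
        ((scanBelow.run (scanAbove.run (υ.setReg .i N))).reg .iᵣ)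
        ((scanBelow.run (scanAbove.run (υ.setReg .i N))).reg .δ)
        ((scanBelow.run (scanAbove.run (υ.setReg .i N))).reg .δlo)
        ((scanBelow.run (scanAbove.run (υ.setReg .i N))).reg .δhi)
      rw [f2 rfl, f2 rfl, f2 rfl, f2 rfl, f2 rfl, f2 rfl]
      simpa using s1

/-! ### Lower bound in terms of the parameters -/

open Classical in
/-- An arc from `X` to `K` is entered from below as far as `X + a + α` and from above as far as
`K - b - β`, so that all marked positions are covered. Then the cost of this is at least that of
covering them from below, from above, or from both sides up to a largest gap. -/
theorem Scanned.cost_le {Q : ℕ → Prop} {X K N r first last gap lo hi Δ : ℕ} {a b α β : ℤ}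
    (h : Scanned (fun j => X < j ∧ j < K ∧ Q j) N r first last gap lo hi)
    (hXK : X < K) (hKN : K ≤ N) (hΔ : Δ ≤ 1) (hΔX : Δ = 1 → Q X) (ha : 0 ≤ a) (hb : 0 ≤ b)
    (hα : 0 ≤ α ∧ α ≤ 1) (hβ : 0 ≤ β ∧ β ≤ 1)
    (hcov : ∀ j : ℕ, X ≤ j → j < K → Q j → j < X + a + α ∨ K - b - β ≤ j) :
    (r = 0 ∧ (Δ : ℤ) ≤ 2 * a + α + 2 * b + β) ∨
    (1 ≤ r ∧ (2 * (K : ℤ) - 2 * first - 1 + Δ ≤ 2 * a + α + 2 * b + β ∨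
      2 * ((last : ℤ) - X) + 1 ≤ 2 * a + α + 2 * b + β)) ∨
    (2 ≤ r ∧ 2 * ((K : ℤ) - X) - 2 * gap ≤ 2 * a + α + 2 * b + β) := by
  have hX : Δ = 1 → (X : ℤ) < X + a + α ∨ K - b - β ≤ X := fun h1 =>
    hcov X le_rfl hXK (hΔX h1)
  by_cases hr : r = 0
  · refine .inl ⟨hr, ?_⟩
    omega
  right
  obtain ⟨f1, ⟨f2, f3, f4⟩, f5⟩ := h.first_spec (by omega)
  obtain ⟨l1, ⟨l2, l3, l4⟩, l5⟩ := h.last_spec (by omega)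
  -- All of the arc's inner marked positions are reached from below: `a + α ≥ last - X + 1` and `α ≤
  -- 1` give the bound.
  by_cases hl : (last : ℤ) < X + a + α
  · exact .inl ⟨by omega, .inr (by omega)⟩
  -- No inner marked position is reached from below, so `first` is reached from above. If `Δ = 1`,
  -- covering `X` costs at least one more step.
  by_cases hf : X + a + α ≤ (first : ℤ)
  · have := hcov first f2.le f3 f4
    exact .inl ⟨by omega, .inl (by omega)⟩
  right
  have hr1 : r ≠ 1 := fun h1 => by have := h.one h1; omega
  refine ⟨by omega, ?_⟩
  -- Otherwise both sides are used. Let `v` be the least marked position not reached from below and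
  -- `u` the greatest one reached. They are consecutive, so `v - u ≤ gap`; reaching `u` costs at
  -- least `2 * (u - X) + 1` and reaching `v` at least `2 * (K - v) - 1`.
  have hex : ∃ v : ℕ, X + a + α ≤ (v : ℤ) ∧ X < v ∧ v < K ∧ Q v := ⟨last, by omega, l2, l3, l4⟩
  obtain ⟨v1, v2, v3, v4⟩ := Nat.find_spec hex
  have vmin := fun j (hj : j < Nat.find hex) => Nat.find_min hex hj
  generalize Nat.find hex = v at v1 v2 v3 v4 vmin
  obtain ⟨u, ⟨u1, u2, u3, u4⟩, umax⟩ : ∃ u : ℕ, ((u : ℤ) < X + a + α ∧ X < u ∧ u < K ∧ Q u) ∧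
      ∀ j : ℕ, ((j : ℤ) < X + a + α ∧ X < j ∧ j < K ∧ Q j) → j ≤ u := by
    have hfst : (first : ℤ) < X + a + α ∧ X < first ∧ first < K ∧ Q first :=
      ⟨by omega, f2, f3, f4⟩
    exact ⟨_, Nat.findGreatest_spec (P := fun j : ℕ => (j : ℤ) < X + a + α ∧ X < j ∧ j < K ∧ Q j)
      f3.le hfst, fun j hj => Nat.le_findGreatest hj.2.2.1.le hj⟩
  have hgap := h.gap_max u v (by omega) (by omega) ⟨u2, u3, u4⟩ ⟨v2, v3, v4⟩ (by
    rintro j hj1 hj2 ⟨j1, j2, j3⟩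
    by_cases hj : (j : ℤ) < X + a + α
    · have := umax j ⟨hj, j1, j2, j3⟩
      omega
    · exact vmin j hj2 ⟨by omega, j1, j2, j3⟩)
  have := hcov v v2.le v3 v4
  omega

section LowerBound

variable {n k : ℕ} {src dst : Server n k} {σ : State}

theorem Measured.Δ₀_le (h : Measured src dst σ) : σ.reg .Δ₀ ≤ 1 := by
  have := h.x_lt
  rw [h.Δ₀_eq]
  exact h.B_le 0 (by omega)

theorem Measured.Δₓ_le (h : Measured src dst σ) : σ.reg .Δₓ ≤ 1 := by
  rw [h.Δₓ_eq]
  exact h.B_le _ h.x_lt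

theorem Measured.Δ₀_iff (h : Measured src dst σ) : σ.reg .Δ₀ = 1 ↔ Marked src dst (0 : ℕ) := by
  have := h.x_lt
  rw [h.Δ₀_eq]
  exact h.B_eq 0 (by omega)

theorem Measured.Δₓ_iff (h : Measured src dst σ) :
    σ.reg .Δₓ = 1 ↔ Marked src dst (σ.reg .x) := by
  rw [h.Δₓ_eq]
  exact h.B_eq _ h.x_lt

/-- The marked positions are covered by the span of a walk to `dst`. -/
theorem Span.cover {ℓ : ℕ} {m M f α β : ℤ} (hs : Span src dst ℓ m M f α β) {j : ℕ}
    (hm : Marked src dst j) : j < M + α ∨ m - β + k ≤ j := by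
  obtain ⟨e, h1, h2, h3⟩ := hs.row _ hm
  obtain ⟨t, ht⟩ := (shift_eq_shift_iff _).1 h3
  -- Here `e = j + k * t`: a lift at or above `j` is bounded by the top of the span, and one at or
  -- below `j - k` by its bottom.
  rcases le_or_gt 0 t with h | h
  · have : 0 ≤ (k : ℤ) * t := by positivity
    omega
  · have : (k : ℤ) * t ≤ k * (-1) := by gcongr; omega
    omega

/-- The four alternatives correspond to the winding number `t`, with `f = x + k * t`, being
positive, at most `-2`, `0` or `-1`. In the last two the excess of the length over `|f|` is the cost
in `Scanned.cost_le`. -/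
theorem Measured.lower_bound (h : Measured src dst σ) {ℓ : ℕ} {m M f α β : ℤ}
    (hs : Span src dst ℓ m M f α β) :
    k + σ.reg .x ≤ ℓ ∨ 2 * k - σ.reg .x ≤ ℓ ∨
    ((σ.reg .r = 0 ∧ σ.reg .x + σ.reg .Δₓ ≤ ℓ) ∨
      (1 ≤ σ.reg .r ∧ (2 * k + σ.reg .x + σ.reg .Δₓ ≤ ℓ + 2 * σ.reg .i₁ + 1 ∨
        2 * σ.reg .iᵣ + 1 ≤ ℓ + σ.reg .x)) ∨
      (2 ≤ σ.reg .r ∧ 2 * k ≤ ℓ + 2 * σ.reg .δ + σ.reg .x)) ∨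
    (k - σ.reg .x ≤ ℓ ∧ (0 < σ.reg .x →
      (σ.reg .s = 0 ∧ k - σ.reg .x + σ.reg .Δ₀ ≤ ℓ) ∨
      (1 ≤ σ.reg .s ∧ (k + σ.reg .x + σ.reg .Δ₀ ≤ ℓ + 2 * σ.reg .jₛ + 1 ∨
        k + 2 * σ.reg .j₁ + 1 ≤ ℓ + σ.reg .x)) ∨
      (2 ≤ σ.reg .s ∧ k + σ.reg .x ≤ ℓ + 2 * σ.reg .ε))) := by
  have hx := h.x_lt
  have h0 := h.Δ₀_le
  have h0x := h.Δₓ_le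
  have habs : |f| = max f (-f) := abs_eq_max_neg
  obtain ⟨s1, s2, s3, s4, s5, s6, s7, s8, -⟩ := id hs
  rw [← h.shift_x, eq_comm, shift_eq_shift_iff] at s8
  obtain ⟨t, ht⟩ := s8
  have hcov := fun j : ℕ => hs.cover (j := j)
  rcases lt_trichotomy t 0 with hneg | rfl | hpos
  · by_cases ht1 : t = -1
    · right; right; right
      subst ht1
      refine ⟨by omega, fun hxpos => ?_⟩
      -- The walk goes from `0` down to `x - k`. It overshoots by `M` above `0` and by `x - k - m`
      -- below its end, which modulo `k` enter the arc `[0, x)` from its two ends.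
      have := h.below.cost_le (X := 0) (Q := fun j => Marked src dst j) (Δ := σ.reg .Δ₀)
        (a := M) (b := σ.reg .x - k - m) (α := α) (β := β) hxpos hx.le h0
        h.Δ₀_iff.1 (by omega) (by omega) s5 s6
        (fun j _ _ hm => by have := hcov j hm; omega)
      omega
    · have : (k : ℤ) * t ≤ k * (-2) := by gcongr; omega
      right; left
      omega
  · right; right; left
    -- The walk goes from `0` up to `x`. The overshoots `M - x` and `-m` enter the arc `[x, k)` from
    -- below and, after wrapping, from above.
    have := h.above.cost_le (X := σ.reg .x) (Q := fun j => Marked src dst j) (Δ := σ.reg .Δₓ)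
      (a := M - σ.reg .x) (b := -m) (α := α) (β := β) hx le_rfl h0x
      h.Δₓ_iff.1 (by omega) (by omega) s5 s6
      (fun j _ _ hm => by have := hcov j hm; omega)
    omega
  · have : (k : ℤ) * 1 ≤ k * t := by gcongr; omega
    left
    omega

end LowerBound

/-! ### Candidate paths -/

/-- The sequence of moves `c^{e₁} b^{e₂} a^{e₃} d^{e₄} c^{e₅} b^{e₆} a^{e₇}`, with covered bits set
to their values in `dst`, is a path from `src` to `dst`, whose column is at distance `x`. -/
structure ValidPath {n k : ℕ} (src dst : Server n k) (x e₁ e₂ e₃ e₄ e₅ e₆ e₇ : ℕ) : Prop where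
  first_b : e₂ = 0 ∨ e₂ = 1 ∧ e₁ < k ∧ Marked src dst e₁
  first_d : e₄ = 0 ∨ e₄ = 1 ∧ e₁ ≤ e₃ ∧ e₂ + e₃ < k ∧ Marked src dst ((e₁ : ℤ) - e₃ - 1)
  second_b : e₆ = 0 ∨ e₆ = 1 ∧ e₂ + e₃ ≤ e₅ ∧ (e₁ : ℤ) - e₃ + e₅ < min 0 ((e₁ : ℤ) - e₃ - e₄) + k ∧
    Marked src dst ((e₁ : ℤ) - e₃ + e₅)
  col : (k : ℤ) ∣ (e₁ : ℤ) - e₃ + e₅ - e₇ - x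
  cover : ∀ j : ℕ, j < k → Marked src dst j →
    (min (min 0 ((e₁ : ℤ) - e₃ - e₄)) ((e₁ : ℤ) - e₃ + e₅ - e₇) ≤ j ∧
      (j : ℤ) < max ((e₁ : ℤ) + e₂) ((e₁ : ℤ) - e₃ + e₅ + e₆)) ∨
    (min (min 0 ((e₁ : ℤ) - e₃ - e₄)) ((e₁ : ℤ) - e₃ + e₅ - e₇) ≤ (j : ℤ) - k ∧
      (j : ℤ) - k < max ((e₁ : ℤ) + e₂) ((e₁ : ℤ) - e₃ + e₅ + e₆))
  total : e₁ + e₂ + e₃ + e₄ + e₅ + e₆ + e₇ ≤ 3 * k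

section Valid

variable {n k : ℕ} {src dst : Server n k} {σ : State}

theorem marked_of_sub {e : ℤ} {j : ℕ} (hj : Marked src dst j) (he : e = j - k) :
    Marked src dst e := by
  rw [he, marked_sub_period]
  exact hj

theorem marked_of_eq {e : ℤ} {j : ℕ} (hj : Marked src dst j) (he : e = j) :
    Marked src dst e := he ▸ hj

/-- The position of a marked node: it is `0`, or `x`, or above or below `x`. -/
theorem Measured.position (h : Measured src dst σ) {j : ℕ} (hj : j < k) (hm : Marked src dst j) :
    (j = 0 ∧ σ.reg .Δ₀ = 1) ∨ (j = σ.reg .x ∧ σ.reg .Δₓ = 1) ∨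
    (0 < j ∧ j < σ.reg .x ∧ 0 < σ.reg .s ∧ σ.reg .jₛ ≤ j ∧ j ≤ σ.reg .j₁ ∧
      (1 < σ.reg .s → j ≤ σ.reg .εlo ∨ σ.reg .εhi ≤ j)) ∨
    (σ.reg .x < j ∧ 0 < σ.reg .r ∧ σ.reg .i₁ ≤ j ∧ j ≤ σ.reg .iᵣ ∧
      (1 < σ.reg .r → j ≤ σ.reg .δlo ∨ σ.reg .δhi ≤ j)) := by
  rcases Nat.eq_zero_or_pos j with rfl | hpos
  · exact .inl ⟨rfl, h.Δ₀_iff.2 hm⟩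
  rcases lt_trichotomy j (σ.reg .x) with hlt | heq | hgt
  · have hs : 0 < σ.reg .s := Nat.pos_of_ne_zero fun h0 => h.below.none h0 j hj ⟨hpos, hlt, hm⟩
    exact .inr (.inr (.inl ⟨hpos, hlt, hs, (h.below.first_spec hs).2.2 j hj ⟨hpos, hlt, hm⟩,
      (h.below.last_spec hs).2.2 j hj ⟨hpos, hlt, hm⟩,
      fun h1 => (h.below.gap_spec h1).2.2.2.2.2 j hj ⟨hpos, hlt, hm⟩⟩))
  · exact .inr (.inl ⟨heq, h.Δₓ_iff.2 (heq ▸ hm)⟩)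
  · have hr : 0 < σ.reg .r := Nat.pos_of_ne_zero fun h0 => h.above.none h0 j hj ⟨hgt, hj, hm⟩
    exact .inr (.inr (.inr ⟨hgt, hr, (h.above.first_spec hr).2.2 j hj ⟨hgt, hj, hm⟩,
      (h.above.last_spec hr).2.2 j hj ⟨hgt, hj, hm⟩,
      fun h1 => (h.above.gap_spec h1).2.2.2.2.2 j hj ⟨hgt, hj, hm⟩⟩))

theorem Measured.Δ₀_cases (h : Measured src dst σ) :
    σ.reg .Δ₀ = 0 ∨ σ.reg .Δ₀ = 1 ∧ 0 < k ∧ Marked src dst (0 : ℕ) := by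
  have h1 := h.Δ₀_le
  have h2 := h.x_lt
  rcases Nat.le_one_iff_eq_zero_or_eq_one.1 h1 with h0 | h0
  · exact .inl h0
  · exact .inr ⟨h0, by omega, h.Δ₀_iff.1 h0⟩

theorem Measured.Δₓ_cases (h : Measured src dst σ) :
    σ.reg .Δₓ = 0 ∨ σ.reg .Δₓ = 1 ∧ σ.reg .x < k ∧ Marked src dst (σ.reg .x) := by
  rcases Nat.le_one_iff_eq_zero_or_eq_one.1 h.Δₓ_le with h0 | h0
  · exact .inl h0
  · exact .inr ⟨h0, h.x_lt, h.Δₓ_iff.1 h0⟩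

theorem Measured.Δₓ_eq_Δ₀ (h : Measured src dst σ) (hx : σ.reg .x = 0) :
    σ.reg .Δₓ = σ.reg .Δ₀ := by
  rw [h.Δₓ_eq, h.Δ₀_eq, hx]

/-- In this and the following lemmas the witness for `col` is the winding number: `1` here, `-2` for
the anticlockwise tour, `0` for candidates using the marked nodes above `x`, and `-1` for those
using the nodes below `x`. -/
theorem Measured.valid_clockwise (h : Measured src dst σ) :
    ValidPath src dst (σ.reg .x) (k + σ.reg .x) 0 0 0 0 0 0 := by
  have hx := h.x_lt
  exact ⟨.inl rfl, .inl rfl, .inl rfl, ⟨1, by omega⟩, fun j hj hm => by omega, by omega⟩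

theorem Measured.valid_anticlockwise (h : Measured src dst σ) :
    ValidPath src dst (σ.reg .x) 0 0 (k + k - σ.reg .x) 0 0 0 0 := by
  have hx := h.x_lt
  exact ⟨.inl rfl, .inl rfl, .inl rfl, ⟨-2, by omega⟩, fun j hj hm => by omega, by omega⟩

/-- `c^x b^{Δₓ}` -/
theorem Measured.valid_above_none (h : Measured src dst σ) (hr : σ.reg .r = 0) :
    ValidPath src dst (σ.reg .x) (σ.reg .x) (σ.reg .Δₓ) 0 0 0 0 0 := by
  have hx0 := h.Δₓ_eq_Δ₀
  have hx := h.x_lt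
  have h1 := h.Δₓ_le
  refine ⟨h.Δₓ_cases, .inl rfl, .inl rfl, ⟨0, by omega⟩, fun j hj hm => ?_, by omega⟩
  have := h.position hj hm
  omega

/-- `b^{Δ₀} a^{k-x}` -/
theorem Measured.valid_below_none (h : Measured src dst σ) (hs : σ.reg .s = 0) :
    ValidPath src dst (σ.reg .x) 0 (σ.reg .Δ₀) (k - σ.reg .x) 0 0 0 0 := by
  have hx := h.x_lt
  have h1 := h.Δ₀_le
  refine ⟨h.Δ₀_cases, .inl rfl, .inl rfl, ⟨-1, by omega⟩, fun j hj hm => ?_, by omega⟩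
  have := h.position hj hm
  omega

/-- `a^{k-i₁-1} d c^{k-i₁-1+x} b^{Δₓ}` -/
theorem Measured.valid_above_first (h : Measured src dst σ) (hr : 0 < σ.reg .r)
    (hx0 : σ.reg .x ≠ 0) :
    ValidPath src dst (σ.reg .x) 0 0 (k - σ.reg .i₁ - 1) 1 (k - σ.reg .i₁ - 1 + σ.reg .x)
      (σ.reg .Δₓ) 0 := by
  have hx := h.x_lt
  have h1 := h.Δₓ_le
  obtain ⟨f1, ⟨f2, f3, f4⟩, f5⟩ := h.above.first_spec hr
  refine ⟨.inl rfl, .inr ⟨rfl, by omega, by omega, marked_of_sub f4 (by omega)⟩, ?_,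
    ⟨0, by omega⟩, fun j hj hm => ?_, by omega⟩
  · rcases h.Δₓ_cases with h0 | ⟨h0, h0', h0''⟩
    · exact .inl h0
    · exact .inr ⟨h0, by omega, by omega, marked_of_eq h0'' (by omega)⟩
  · have := h.position hj hm
    omega

/-- `b^{Δ₀} a^{k-i₁-1} d c^{k-i₁-1}` -/
theorem Measured.valid_same_first (h : Measured src dst σ) (hr : 0 < σ.reg .r)
    (hx0 : σ.reg .x = 0) :
    ValidPath src dst (σ.reg .x) 0 (σ.reg .Δ₀) (k - σ.reg .i₁ - 1) 1 (k - σ.reg .i₁ - 1) 0 0 := by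
  have hΔ := h.Δₓ_eq_Δ₀ hx0
  have h1 := h.Δ₀_le
  obtain ⟨f1, ⟨f2, f3, f4⟩, f5⟩ := h.above.first_spec hr
  refine ⟨h.Δ₀_cases, .inr ⟨rfl, by omega, by omega, marked_of_sub f4 (by omega)⟩, .inl rfl,
    ⟨0, by omega⟩, fun j hj hm => ?_, by omega⟩
  have := h.position hj hm
  omega

/-- `c^{iᵣ} b a^{iᵣ-x}` -/
theorem Measured.valid_above_last (h : Measured src dst σ) (hr : 0 < σ.reg .r) :
    ValidPath src dst (σ.reg .x) (σ.reg .iᵣ) 1 (σ.reg .iᵣ - σ.reg .x) 0 0 0 0 := by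
  have hx := h.x_lt
  obtain ⟨f1, ⟨f2, f3, f4⟩, f5⟩ := h.above.last_spec hr
  refine ⟨.inr ⟨rfl, f1, f4⟩, .inl rfl, .inl rfl, ⟨0, by omega⟩, fun j hj hm => ?_, by omega⟩
  have := h.position hj hm
  omega

/-- `b^{Δ₀} a^{k-jₛ-1} d c^{x-jₛ-1}` -/
theorem Measured.valid_below_first (h : Measured src dst σ) (hs : 0 < σ.reg .s) :
    ValidPath src dst (σ.reg .x) 0 (σ.reg .Δ₀) (k - σ.reg .jₛ - 1) 1 (σ.reg .x - σ.reg .jₛ - 1)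
      0 0 := by
  have hx := h.x_lt
  have h1 := h.Δ₀_le
  obtain ⟨f1, ⟨f2, f3, f4⟩, f5⟩ := h.below.first_spec hs
  refine ⟨h.Δ₀_cases, .inr ⟨rfl, by omega, by omega, marked_of_sub f4 (by omega)⟩, .inl rfl,
    ⟨-1, by omega⟩, fun j hj hm => ?_, by omega⟩
  have := h.position hj hm
  omega

/-- `c^{j₁} b a^{k+j₁-x}` -/
theorem Measured.valid_below_last (h : Measured src dst σ) (hs : 0 < σ.reg .s) :
    ValidPath src dst (σ.reg .x) (σ.reg .j₁) 1 (k + σ.reg .j₁ - σ.reg .x) 0 0 0 0 := by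
  have hx := h.x_lt
  obtain ⟨f1, ⟨f2, f3, f4⟩, f5⟩ := h.below.last_spec hs
  refine ⟨.inr ⟨rfl, f1, f4⟩, .inl rfl, .inl rfl, ⟨-1, by omega⟩, fun j hj hm => ?_, by omega⟩
  have := h.position hj hm
  omega

/-- `a^{k-δhi-1} d c^{k-δhi-1+δlo} b a^{δlo-x}` -/
theorem Measured.valid_above_gap (h : Measured src dst σ) (hr : 1 < σ.reg .r) :
    ValidPath src dst (σ.reg .x) 0 0 (k - σ.reg .δhi - 1) 1 (k - σ.reg .δhi - 1 + σ.reg .δlo) 1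
      (σ.reg .δlo - σ.reg .x) := by
  have hx := h.x_lt
  obtain ⟨⟨f1, f2, f3⟩, ⟨g1, g2, g3⟩, g4, g5, g6, g7⟩ := h.above.gap_spec hr
  refine ⟨.inl rfl, .inr ⟨rfl, by omega, by omega, marked_of_sub g3 (by omega)⟩,
    .inr ⟨rfl, by omega, by omega, marked_of_eq f3 (by omega)⟩,
    ⟨0, by omega⟩, fun j hj hm => ?_, by omega⟩
  have := h.position hj hm
  omega

/-- `c^{εlo} b a^{εlo+k-εhi-1} d c^{x-εhi-1}` -/
theorem Measured.valid_below_gap (h : Measured src dst σ) (hs : 1 < σ.reg .s) :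
    ValidPath src dst (σ.reg .x) (σ.reg .εlo) 1 (σ.reg .εlo + k - σ.reg .εhi - 1) 1
      (σ.reg .x - σ.reg .εhi - 1) 0 0 := by
  have hx := h.x_lt
  obtain ⟨⟨f1, f2, f3⟩, ⟨g1, g2, g3⟩, g4, g5, g6, g7⟩ := h.below.gap_spec hs
  refine ⟨.inr ⟨rfl, by omega, f3⟩,
    .inr ⟨rfl, by omega, by omega, marked_of_sub g3 (by omega)⟩, .inl rfl,
    ⟨-1, by omega⟩, fun j hj hm => ?_, by omega⟩
  have := h.position hj hm
  omega

end Valid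

/-! ### Comparison of the candidates -/

/-- The registers in which the current path is held. -/
def Reg.isPath : Reg → Bool
  | .L | .e₁ | .e₂ | .e₃ | .e₄ | .e₅ | .e₆ | .e₇ => true
  | _ => false

/-- The expression does not depend on the current path. -/
def Expr.indep : Expr → Bool
  | .lit _ => true
  | .reg v => !v.isPath
  | .get _ e => e.indep
  | .add e f => e.indep && f.indep
  | .sub e f => e.indep && f.indep

/-- The test does not depend on the current path. -/
def Test.indep : Test → Bool
  | .lt e f => e.indep && f.indep
  | .eq e f => e.indep && f.indep
  | .not t => t.indep
  | .and t u => t.indep && u.indep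

/-- The states differ at most in the current path. -/
structure Agree (σ τ : State) : Prop where
  reg : ∀ v, v.isPath = false → τ.reg v = σ.reg v
  arr : τ.arr = σ.arr
  out : τ.out = σ.out

theorem Agree.refl (σ : State) : Agree σ σ := ⟨fun _ _ => rfl, rfl, rfl⟩

theorem Agree.setReg {σ τ : State} (h : Agree σ τ) {v : Reg} (hv : v.isPath = true) (m : ℕ) :
    Agree σ (τ.setReg v m) := by
  refine ⟨fun w hw => ?_, h.arr, h.out⟩
  rw [setReg_reg, if_neg, h.reg w hw]
  rintro rfl
  simp [hv] at hw

/-- Candidate lengths and exponents read only the parameters, so they can all be evaluated in the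
one state `σ` even while the current path is being overwritten. -/
theorem Agree.eval {σ τ : State} (h : Agree σ τ) {e : Expr} (he : e.indep = true) :
    e.eval τ = e.eval σ := by
  induction e with
  | lit m => rfl
  | reg v => exact h.reg v (by simpa [Expr.indep] using he)
  | get A e ih => simp only [eval_get, h.arr, ih he]
  | add e f ihe ihf =>
    simp only [Expr.indep, Bool.and_eq_true] at he
    simp only [Expr.eval, ihe he.1, ihf he.2]
  | sub e f ihe ihf =>
    simp only [Expr.indep, Bool.and_eq_true] at he
    simp only [Expr.eval, ihe he.1, ihf he.2]

theorem Agree.test {σ τ : State} (h : Agree σ τ) {t : Test} (ht : t.indep = true) :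
    t.eval τ = t.eval σ := by
  induction t with
  | lt e f =>
    simp only [Test.indep, Bool.and_eq_true] at ht
    simp only [Test.eval, h.eval ht.1, h.eval ht.2]
  | eq e f =>
    simp only [Test.indep, Bool.and_eq_true] at ht
    simp only [Test.eval, h.eval ht.1, h.eval ht.2]
  | not t ih => simp only [Test.eval, ih ht]
  | and t u iht ihu =>
    simp only [Test.indep, Bool.and_eq_true] at ht
    simp only [Test.eval, iht ht.1, ihu ht.2]

/-- The current path is a path from `src` to `dst` of the recorded length. -/
structure Current {n k : ℕ} (src dst : Server n k) (σ τ : State) : Prop where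
  agree : Agree σ τ
  valid : ValidPath src dst (σ.reg .x) (τ.reg .e₁) (τ.reg .e₂) (τ.reg .e₃) (τ.reg .e₄) (τ.reg .e₅)
    (τ.reg .e₆) (τ.reg .e₇)
  length : τ.reg .L = τ.reg .e₁ + τ.reg .e₂ + τ.reg .e₃ + τ.reg .e₄ + τ.reg .e₅ + τ.reg .e₆ +
    τ.reg .e₇

/-- The expressions describe a path from `src` to `dst` and its length. -/
structure Sound {n k : ℕ} (src dst : Server n k) (σ : State)
    (len f₁ f₂ f₃ f₄ f₅ f₆ f₇ : Expr) : Prop where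
  indep : (len.indep && f₁.indep && f₂.indep && f₃.indep && f₄.indep && f₅.indep && f₆.indep &&
    f₇.indep) = true
  valid : ValidPath src dst (σ.reg .x) (f₁.eval σ) (f₂.eval σ) (f₃.eval σ) (f₄.eval σ) (f₅.eval σ)
    (f₆.eval σ) (f₇.eval σ)
  length : len.eval σ = f₁.eval σ + f₂.eval σ + f₃.eval σ + f₄.eval σ + f₅.eval σ + f₆.eval σ +
    f₇.eval σ

section Candidates

variable {n k : ℕ} {src dst : Server n k} {σ τ : State} {len f₁ f₂ f₃ f₄ f₅ f₆ f₇ : Expr} {ℓ : ℕ}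

theorem Sound.choosePath (h : Sound src dst σ len f₁ f₂ f₃ f₄ f₅ f₆ f₇) (hτ : Agree σ τ) :
    Current src dst σ ((choosePath len f₁ f₂ f₃ f₄ f₅ f₆ f₇).run τ) ∧
      ((choosePath len f₁ f₂ f₃ f₄ f₅ f₆ f₇).run τ).reg .L = len.eval σ := by
  obtain ⟨hi, hv, hl⟩ := h
  simp only [Bool.and_eq_true] at hi
  obtain ⟨⟨⟨⟨⟨⟨⟨i0, i1⟩, i2⟩, i3⟩, i4⟩, i5⟩, i6⟩, i7⟩ := hi
  simp only [DPillar.choosePath, run_block_cons, run_block_nil, run_set]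
  have a0 := hτ.setReg (v := .L) rfl (len.eval σ)
  have a1 := a0.setReg (v := .e₁) rfl (f₁.eval σ)
  have a2 := a1.setReg (v := .e₂) rfl (f₂.eval σ)
  have a3 := a2.setReg (v := .e₃) rfl (f₃.eval σ)
  have a4 := a3.setReg (v := .e₄) rfl (f₄.eval σ)
  have a5 := a4.setReg (v := .e₅) rfl (f₅.eval σ)
  have a6 := a5.setReg (v := .e₆) rfl (f₆.eval σ)
  have a7 := a6.setReg (v := .e₇) rfl (f₇.eval σ)
  rw [hτ.eval i0, a0.eval i1, a1.eval i2, a2.eval i3, a3.eval i4, a4.eval i5, a5.eval i6,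
    a6.eval i7]
  refine ⟨⟨a7, ?_, ?_⟩, ?_⟩
  · simpa [setReg_reg] using hv
  · simpa [setReg_reg] using hl
  · simp [setReg_reg]

/-- Running `P` keeps a valid path current and never makes it longer; if `A` holds, its length is
at most `ℓ` afterwards. -/
def Improves {n k : ℕ} (src dst : Server n k) (σ : State) (ℓ : ℕ) (P : Stmt) (A : Prop) : Prop :=
  ∀ τ, Current src dst σ τ → Current src dst σ (P.run τ) ∧ (P.run τ).reg .L ≤ τ.reg .L ∧
    (A → (P.run τ).reg .L ≤ ℓ)

theorem improves_nil : Improves src dst σ ℓ (block []) False :=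
  fun _ h => ⟨h, le_rfl, False.elim⟩

/-- As `L` never increases, a bound achieved by one candidate survives all later ones. A block
therefore yields a disjunction, with one disjunct per statement. -/
theorem Improves.cons {P : Stmt} {Ps : List Stmt} {A B : Prop} (hP : Improves src dst σ ℓ P A)
    (hPs : Improves src dst σ ℓ (block Ps) B) :
    Improves src dst σ ℓ (block (P :: Ps)) (A ∨ B) := by
  intro τ hτ
  obtain ⟨h1, h2, h3⟩ := hP τ hτ
  obtain ⟨g1, g2, g3⟩ := hPs _ h1
  refine ⟨g1, g2.trans h2, ?_⟩
  rintro (hA | hB)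
  · exact g2.trans (h3 hA)
  · exact g3 hB

theorem improves_when {t : Test} {P : Stmt} {A : Prop} (ht : t.indep = true)
    (hP : t.eval σ = true → Improves src dst σ ℓ P A) :
    Improves src dst σ ℓ (DPillar.when t P) (t.eval σ = true ∧ A) := by
  intro τ hτ
  rw [run_when, hτ.agree.test ht]
  split_ifs with h
  · obtain ⟨h1, h2, h3⟩ := hP h τ hτ
    exact ⟨h1, h2, fun hA => h3 hA.2⟩
  · exact ⟨hτ, le_rfl, fun hA => absurd hA.1 h⟩

theorem Sound.consider (h : Sound src dst σ len f₁ f₂ f₃ f₄ f₅ f₆ f₇) :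
    Improves src dst σ ℓ (consider len f₁ f₂ f₃ f₄ f₅ f₆ f₇) (len.eval σ ≤ ℓ) := by
  intro τ hτ
  have hlen : len.eval τ = len.eval σ := by
    have := h.indep
    simp only [Bool.and_eq_true] at this
    exact hτ.agree.eval this.1.1.1.1.1.1.1
  rw [DPillar.consider, run_when]
  simp only [test_lt, eval_reg, hlen]
  split_ifs with hlt
  · obtain ⟨h1, h2⟩ := h.choosePath hτ.agree
    exact ⟨h1, by omega, fun hA => by omega⟩
  · exact ⟨hτ, le_rfl, fun hA => by omega⟩

/-! ### Lengths of the candidates as sums of their exponents -/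

theorem Measured.sound_clockwise (h : Measured src dst σ) :
    Sound src dst σ (Reg.k + Reg.x : Expr) (Reg.k + Reg.x : Expr) 0 0 0 0 0 0 := by
  refine ⟨rfl, by simpa [h.reg_k] using h.valid_clockwise, ?_⟩
  have hk := h.reg_k
  have hx := h.x_lt
  simp only [eval_add, eval_reg, eval_zero]
  omega

theorem Measured.sound_anticlockwise (h : Measured src dst σ) :
    Sound src dst σ (Reg.k + Reg.k - Reg.x : Expr) 0 0 (Reg.k + Reg.k - Reg.x : Expr) 0 0 0 0 := by
  refine ⟨rfl, by simpa [h.reg_k] using h.valid_anticlockwise, ?_⟩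
  have hk := h.reg_k
  have hx := h.x_lt
  simp only [eval_add, eval_sub, eval_reg, eval_zero]
  omega

theorem Measured.sound_above_none (h : Measured src dst σ) (hr : σ.reg .r = 0) :
    Sound src dst σ (Reg.x + Reg.Δₓ : Expr) Reg.x Reg.Δₓ 0 0 0 0 0 := by
  refine ⟨rfl, by simpa [h.reg_k] using h.valid_above_none hr, ?_⟩
  have hk := h.reg_k
  have hx := h.x_lt
  simp only [eval_add, eval_reg, eval_zero]
  omega

theorem Measured.sound_below_none (h : Measured src dst σ) (hs : σ.reg .s = 0) :
    Sound src dst σ (Reg.k - Reg.x + Reg.Δ₀ : Expr) 0 Reg.Δ₀ (Reg.k - Reg.x : Expr) 0 0 0 0 := by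
  refine ⟨rfl, by simpa [h.reg_k] using h.valid_below_none hs, ?_⟩
  have hk := h.reg_k
  have hx := h.x_lt
  simp only [eval_add, eval_sub, eval_reg, eval_zero]
  omega

theorem Measured.sound_above_first (h : Measured src dst σ) (hr : 0 < σ.reg .r) (hx0 : σ.reg .x ≠ 0) :
    Sound src dst σ (Reg.k + Reg.k + Reg.x + Reg.Δₓ - Reg.i₁ - Reg.i₁ - 1 : Expr) 0 0
      (Reg.k - Reg.i₁ - 1 : Expr) 1 (Reg.k - Reg.i₁ - 1 + Reg.x : Expr) Reg.Δₓ 0 := by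
  refine ⟨rfl, by simpa [h.reg_k] using h.valid_above_first hr hx0, ?_⟩
  have hk := h.reg_k
  have hx := h.x_lt
  -- The bounds `x < i₁ < k` keep all the truncated subtractions exact.
  have hf := (h.above.first_spec hr).2.1.1
  have hf' := (h.above.first_spec hr).1
  simp only [eval_add, eval_sub, eval_reg, eval_zero, eval_one]
  omega

theorem Measured.sound_above_last (h : Measured src dst σ) (hr : 0 < σ.reg .r) :
    Sound src dst σ (Reg.iᵣ + Reg.iᵣ + 1 - Reg.x : Expr) Reg.iᵣ 1 (Reg.iᵣ - Reg.x : Expr) 0 0 0 0 := by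
  refine ⟨rfl, by simpa [h.reg_k] using h.valid_above_last hr, ?_⟩
  have hk := h.reg_k
  have hx := h.x_lt
  have hl := (h.above.last_spec hr).2.1.1
  have hl' := (h.above.last_spec hr).1
  simp only [eval_add, eval_sub, eval_reg, eval_zero, eval_one]
  omega

theorem Measured.sound_above_unique (h : Measured src dst σ) (hr : σ.reg .r = 1) :
    Sound src dst σ (Reg.i₁ + Reg.i₁ + 1 - Reg.x : Expr) Reg.i₁ 1 (Reg.i₁ - Reg.x : Expr) 0 0 0 0 := by
  refine ⟨rfl, by simpa [h.reg_k, h.above.one hr] using h.valid_above_last (by omega), ?_⟩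
  have hk := h.reg_k
  have hx := h.x_lt
  have hf := (h.above.first_spec (by omega)).2.1.1
  have hf' := (h.above.first_spec (by omega)).1
  simp only [eval_add, eval_sub, eval_reg, eval_zero, eval_one]
  omega

theorem Measured.sound_below_first (h : Measured src dst σ) (hs : 0 < σ.reg .s) :
    Sound src dst σ (Reg.k + Reg.x + Reg.Δ₀ - Reg.jₛ - Reg.jₛ - 1 : Expr) 0 Reg.Δ₀
      (Reg.k - Reg.jₛ - 1 : Expr) 1 (Reg.x - Reg.jₛ - 1 : Expr) 0 0 := by
  refine ⟨rfl, by simpa [h.reg_k] using h.valid_below_first hs, ?_⟩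
  have hk := h.reg_k
  have hx := h.x_lt
  have hf := (h.below.first_spec hs).2.1.1
  have hf' := (h.below.first_spec hs).2.1.2.1
  simp only [eval_add, eval_sub, eval_reg, eval_zero, eval_one]
  omega

theorem Measured.sound_below_unique (h : Measured src dst σ) (hs : σ.reg .s = 1) :
    Sound src dst σ (Reg.k + Reg.x + Reg.Δ₀ - Reg.j₁ - Reg.j₁ - 1 : Expr) 0 Reg.Δ₀
      (Reg.k - Reg.j₁ - 1 : Expr) 1 (Reg.x - Reg.j₁ - 1 : Expr) 0 0 := by
  refine ⟨rfl, by simpa [h.reg_k, h.below.one hs] using h.valid_below_first (by omega), ?_⟩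
  have hk := h.reg_k
  have hx := h.x_lt
  have hl := (h.below.last_spec (by omega)).2.1.1
  have hl' := (h.below.last_spec (by omega)).2.1.2.1
  simp only [eval_add, eval_sub, eval_reg, eval_zero, eval_one]
  omega

theorem Measured.sound_below_last (h : Measured src dst σ) (hs : 0 < σ.reg .s) :
    Sound src dst σ (Reg.k + Reg.j₁ + Reg.j₁ + 1 - Reg.x : Expr) Reg.j₁ 1
      (Reg.k + Reg.j₁ - Reg.x : Expr) 0 0 0 0 := by
  refine ⟨rfl, by simpa [h.reg_k] using h.valid_below_last hs, ?_⟩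
  have hk := h.reg_k
  have hx := h.x_lt
  have hl := (h.below.last_spec hs).2.1.1
  have hl' := (h.below.last_spec hs).2.1.2.1
  simp only [eval_add, eval_sub, eval_reg, eval_zero, eval_one]
  omega

theorem Measured.sound_above_gap (h : Measured src dst σ) (hr : 1 < σ.reg .r) :
    Sound src dst σ (Reg.k + Reg.k - Reg.δ - Reg.δ - Reg.x : Expr) 0 0
      (Reg.k - Reg.δhi - 1 : Expr) 1 (Reg.k - Reg.δhi - 1 + Reg.δlo : Expr) 1
      (Reg.δlo - Reg.x : Expr) := by
  refine ⟨rfl, by simpa [h.reg_k] using h.valid_above_gap hr, ?_⟩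
  have hk := h.reg_k
  have hx := h.x_lt
  obtain ⟨⟨f1, f2, -⟩, ⟨g1, g2, -⟩, g4, -⟩ := h.above.gap_spec hr
  simp only [eval_add, eval_sub, eval_reg, eval_zero, eval_one]
  omega

theorem Measured.sound_below_gap (h : Measured src dst σ) (hs : 1 < σ.reg .s) :
    Sound src dst σ (Reg.k + Reg.x - Reg.ε - Reg.ε : Expr) Reg.εlo 1
      (Reg.εlo + Reg.k - Reg.εhi - 1 : Expr) 1 (Reg.x - Reg.εhi - 1 : Expr) 0 0 := by
  refine ⟨rfl, by simpa [h.reg_k] using h.valid_below_gap hs, ?_⟩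
  have hk := h.reg_k
  have hx := h.x_lt
  obtain ⟨⟨f1, f2, -⟩, ⟨g1, g2, -⟩, g4, -⟩ := h.below.gap_spec hs
  simp only [eval_add, eval_sub, eval_reg, eval_zero, eval_one]
  omega

theorem Measured.sound_same_none (h : Measured src dst σ) (hx0 : σ.reg .x = 0)
    (hr : σ.reg .r = 0) (hΔ : σ.reg .Δ₀ = 1) :
    Sound src dst σ 1 0 1 0 0 0 0 0 := by
  refine ⟨rfl, by simpa [h.reg_k, hx0, h.Δₓ_eq_Δ₀ hx0, hΔ] using h.valid_above_none hr, rfl⟩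

theorem Measured.sound_same_clockwise (h : Measured src dst σ) (hx0 : σ.reg .x = 0) :
    Sound src dst σ Reg.k Reg.k 0 0 0 0 0 0 := by
  refine ⟨rfl, by simpa [h.reg_k, hx0] using h.valid_clockwise, ?_⟩
  have hk := h.reg_k
  have hx := h.x_lt
  simp only [eval_reg, eval_zero]
  omega

theorem Measured.sound_same_first (h : Measured src dst σ) (hx0 : σ.reg .x = 0)
    (hr : 0 < σ.reg .r) :
    Sound src dst σ (Reg.k + Reg.k + Reg.Δ₀ - Reg.i₁ - Reg.i₁ - 1 : Expr) 0 Reg.Δ₀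
      (Reg.k - Reg.i₁ - 1 : Expr) 1 (Reg.k - Reg.i₁ - 1 : Expr) 0 0 := by
  refine ⟨rfl, by simpa [h.reg_k] using h.valid_same_first hr hx0, ?_⟩
  have hk := h.reg_k
  have hx := h.x_lt
  have hf := (h.above.first_spec hr).2.1.1
  have hf' := (h.above.first_spec hr).1
  simp only [eval_add, eval_sub, eval_reg, eval_zero, eval_one]
  omega

theorem Measured.sound_same_last (h : Measured src dst σ) (hx0 : σ.reg .x = 0)
    (hr : 0 < σ.reg .r) :
    Sound src dst σ (Reg.iᵣ + Reg.iᵣ + 1 : Expr) Reg.iᵣ 1 Reg.iᵣ 0 0 0 0 := by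
  refine ⟨rfl, by simpa [h.reg_k, hx0] using h.valid_above_last hr, ?_⟩
  have hk := h.reg_k
  have hx := h.x_lt
  have hl := (h.above.last_spec hr).2.1.1
  have hl' := (h.above.last_spec hr).1
  simp only [eval_add, eval_reg, eval_zero, eval_one]
  omega

theorem Measured.sound_same_unique (h : Measured src dst σ) (hx0 : σ.reg .x = 0)
    (hr : σ.reg .r = 1) :
    Sound src dst σ (Reg.i₁ + Reg.i₁ + 1 : Expr) Reg.i₁ 1 Reg.i₁ 0 0 0 0 := by
  refine ⟨rfl, by simpa [h.reg_k, hx0, h.above.one hr] using h.valid_above_last (by omega), ?_⟩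
  have hk := h.reg_k
  have hx := h.x_lt
  have hf := (h.above.first_spec (by omega)).2.1.1
  have hf' := (h.above.first_spec (by omega)).1
  simp only [eval_add, eval_reg, eval_zero, eval_one]
  omega

theorem Measured.sound_same_gap (h : Measured src dst σ) (hx0 : σ.reg .x = 0)
    (hr : 1 < σ.reg .r) :
    Sound src dst σ (Reg.k + Reg.k - Reg.δ - Reg.δ : Expr) 0 0
      (Reg.k - Reg.δhi - 1 : Expr) 1 (Reg.k - Reg.δhi - 1 + Reg.δlo : Expr) 1 Reg.δlo := by
  refine ⟨rfl, by simpa [h.reg_k, hx0] using h.valid_above_gap hr, ?_⟩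
  have hk := h.reg_k
  have hx := h.x_lt
  obtain ⟨⟨f1, f2, -⟩, ⟨g1, g2, -⟩, g4, -⟩ := h.above.gap_spec hr
  simp only [eval_add, eval_sub, eval_reg, eval_zero, eval_one]
  omega

theorem Measured.sound_same_highest (h : Measured src dst σ) (hx0 : σ.reg .x = 0)
    (hr : 0 < σ.reg .r) (hi : σ.reg .i₁ = k - 1) :
    Sound src dst σ (1 + Reg.Δ₀ : Expr) 0 Reg.Δ₀ 0 1 0 0 0 := by
  have this := h.valid_same_first hr hx0
  rw [hi, Nat.sub_sub_self (by have := h.x_lt; omega), Nat.sub_self] at this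
  refine ⟨rfl, by simpa [h.reg_k] using this, ?_⟩
  have hk := h.reg_k
  have hx := h.x_lt
  simp only [eval_add, eval_reg, eval_zero, eval_one]
  omega

theorem Measured.sound_same_lowest (h : Measured src dst σ) (hx0 : σ.reg .x = 0)
    (hr : σ.reg .r = 1) (hi : σ.reg .i₁ = 1) :
    Sound src dst σ 3 1 1 1 0 0 0 0 := by
  refine ⟨rfl, by simpa [h.reg_k, hx0, ← h.above.one hr, hi] using h.valid_above_last (by omega), rfl⟩

/-- If the state `τ` holds a valid path, of length at most `ℓ` if `T` or else `A` holds, then it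
holds a valid path after running `P`, of length at most `ℓ` if `T`. -/
theorem Improves.conclude {P : Stmt} {A T : Prop} (hP : Improves src dst σ ℓ P A)
    (hτ : Current src dst σ τ) (hT : T → A ∨ τ.reg .L ≤ ℓ) :
    Current src dst σ (P.run τ) ∧ (T → (P.run τ).reg .L ≤ ℓ) := by
  obtain ⟨h1, h2, h3⟩ := hP τ hτ
  exact ⟨h1, fun t => (hT t).elim h3 h2.trans⟩

theorem Improves.pass {P : Stmt} {A T : Prop} (hP : Improves src dst σ ℓ P A)
    (hτ : Current src dst σ τ ∧ (T → τ.reg .L ≤ ℓ)) :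
    Current src dst σ (P.run τ) ∧ (T → (P.run τ).reg .L ≤ ℓ) :=
  hP.conclude hτ.1 fun t => .inr (hτ.2 t)

/-! ### Optimality of the selected candidate -/

theorem candidatesDistinct_spec (h : Measured src dst σ) (hx0 : σ.reg .x ≠ 0) :
    Current src dst σ (candidatesDistinct.run σ) ∧ ((∃ m M f α β, Span src dst ℓ m M f α β) →
      (candidatesDistinct.run σ).reg .L ≤ ℓ) := by
  have hx := h.x_lt
  have hk := h.reg_k
  have ao := h.above.one
  have bo := h.below.one
  obtain ⟨h1, h2⟩ := h.sound_clockwise.choosePath (Agree.refl σ)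
  -- The resulting disjunction lists the candidates in program order; each alternative of the lower
  -- bound is sent to the disjunct of the matching candidate.
  have main := Improves.cons (ℓ := ℓ) h.sound_anticlockwise.consider
    (.cons (improves_when (t := .eq Reg.r 0) rfl fun ht =>
      (h.sound_above_none (by simpa using ht)).consider)
    (.cons (improves_when (t := .eq Reg.s 0) rfl fun ht =>
      (h.sound_below_none (by simpa using ht)).consider)
    (.cons (improves_when (t := .eq Reg.r 1) rfl fun ht =>
      have ht : σ.reg .r = 1 := by simpa using ht
      .cons (h.sound_above_first (by omega) hx0).consider
        (.cons (h.sound_above_unique ht).consider improves_nil))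
    (.cons (improves_when (t := .eq Reg.s 1) rfl fun ht =>
      have ht : σ.reg .s = 1 := by simpa using ht
      .cons (h.sound_below_unique ht).consider
        (.cons (h.sound_below_last (by omega)).consider improves_nil))
    (.cons (improves_when (t := .lt 1 Reg.r) rfl fun ht =>
      have ht : 1 < σ.reg .r := by simpa using ht
      .cons (h.sound_above_gap ht).consider
        (.cons (h.sound_above_first (by omega) hx0).consider
          (.cons (h.sound_above_last (by omega)).consider improves_nil)))
    (.cons (improves_when (t := .lt 1 Reg.s) rfl fun ht =>
      have ht : 1 < σ.reg .s := by simpa using ht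
      .cons (h.sound_below_gap ht).consider
        (.cons (h.sound_below_first (by omega)).consider
          (.cons (h.sound_below_last (by omega)).consider improves_nil)))
    improves_nil))))))
  obtain ⟨g1, g2, g3⟩ := main _ h1
  rw [candidatesDistinct, run_block_cons]
  refine ⟨g1, fun ⟨m, M, f, α, β, hs⟩ => ?_⟩
  rw [h2] at g2
  simp only [eval_add, eval_reg, hk] at g2
  rcases h.lower_bound hs with hlow | hlow | hlow | ⟨-, hlow⟩
  · exact g2.trans hlow
  all_goals
    refine g3 ?_
    simp only [test_eq, test_lt, eval_add, eval_sub, eval_reg, eval_zero, eval_one, hk]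
    clear main g1 g2 g3 h1 h2 h hs hk
  · exact .inl (by omega)
  · right
    rcases hlow with hlow | ⟨hr, hlow⟩ | hlow
    · exact .inl hlow
    -- The program treats `r = 1` separately and writes `i₁` in both candidates there; `ao`
    -- identifies it with `iᵣ`.
    · by_cases hr1 : σ.reg .r = 1
      · exact .inr (.inr (.inl ⟨hr1, by omega⟩))
      · exact .inr (.inr (.inr (.inr (.inl ⟨by omega, by omega⟩))))
    · exact .inr (.inr (.inr (.inr (.inl ⟨by omega, by omega⟩))))
  · right; right
    rcases hlow (by omega) with hlow | ⟨hr, hlow⟩ | hlow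
    · exact .inl hlow
    · by_cases hr1 : σ.reg .s = 1
      · exact .inr (.inr (.inl ⟨hr1, by omega⟩))
      · exact .inr (.inr (.inr (.inr (.inl ⟨by omega, by omega⟩))))
    · exact .inr (.inr (.inr (.inr (.inl ⟨by omega, by omega⟩))))

theorem run_when_pos {t : Test} {P : Stmt} (h : t.eval σ = true) :
    (DPillar.when t P).run σ = P.run σ := by
  rw [run_when, if_pos h]

theorem run_when_neg {t : Test} {P : Stmt} (h : ¬ t.eval σ = true) :
    (DPillar.when t P).run σ = σ := by
  rw [run_when, if_neg h]

/-- The servers share a column, so their rows differ somewhere, and with nothing marked above `0`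
the only place left is `0`. This makes the single step `b` legitimate. -/
theorem Measured.Δ₀_eq_one (h : Measured src dst σ) (hne : src ≠ dst) (hx : σ.reg .x = 0)
    (hr : σ.reg .r = 0) : σ.reg .Δ₀ = 1 := by
  by_contra hΔ
  refine hne ?_
  have hΔ' := h.Δₓ_eq_Δ₀ hx
  ext i
  · have := h.shift_x
    rw [hx, Nat.cast_zero, shift_zero] at this
    rw [this]
  · obtain ⟨j, hj, rfl⟩ := exists_shift_eq src.col i
    by_contra hm
    have := h.position hj fun heq => hm (congrArg Fin.val heq)
    omega

/-- When `x = 0`, every nonzero winding number costs at least `k` steps, so only winding number `0`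
needs the finer analysis. -/
theorem Measured.lower_bound_same (h : Measured src dst σ) (hx : σ.reg .x = 0)
    (hs : ∃ m M f α β, Span src dst ℓ m M f α β) :
    k ≤ ℓ ∨ (σ.reg .r = 0 ∧ σ.reg .Δ₀ ≤ ℓ) ∨
    (1 ≤ σ.reg .r ∧ (2 * k + σ.reg .Δ₀ ≤ ℓ + 2 * σ.reg .i₁ + 1 ∨ 2 * σ.reg .iᵣ + 1 ≤ ℓ)) ∨
    (2 ≤ σ.reg .r ∧ 2 * k ≤ ℓ + 2 * σ.reg .δ) := by
  obtain ⟨m, M, f, α, β, hs⟩ := hs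
  have := h.lower_bound hs
  have := h.Δₓ_eq_Δ₀ hx
  omega

/-- The tour `c^k` is tried only if `r ≥ 2`, so for `r ≤ 1` it must be seen that another candidate
has length at most `k`. -/
theorem candidatesSame_spec (h : Measured src dst σ) (hne : src ≠ dst) (hx0 : σ.reg .x = 0) :
    Current src dst σ (candidatesSame.run σ) ∧ ((∃ m M f α β, Span src dst ℓ m M f α β) →
      (candidatesSame.run σ).reg .L ≤ ℓ) := by
  have hx := h.x_lt
  have hk := h.reg_k
  have hΔ := h.Δ₀_le
  have hlow := h.lower_bound_same (ℓ := ℓ) hx0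
  rw [candidatesSame, run_block_cons]
  by_cases hr0 : σ.reg .r = 0
  · rw [run_when_pos (by simpa using hr0)]
    obtain ⟨h1, h2⟩ := (h.sound_same_none hx0 hr0 (h.Δ₀_eq_one hne hx0 hr0)).choosePath
      (Agree.refl σ)
    have hΔ1 := h.Δ₀_eq_one hne hx0 hr0
    rw [eval_one] at h2
    refine Improves.pass (.cons (improves_when (A := False) rfl fun ht => absurd ht (by simp [hr0]))
      (.cons (improves_when (A := False) rfl fun ht => absurd ht (by simp [hr0])) improves_nil))
      ⟨h1, fun hT => ?_⟩
    have := hlow hT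
    omega
  rw [run_when_neg (by simpa using hr0), run_block_cons]
  by_cases hr1 : σ.reg .r = 1
  · have hi := h.above.one hr1
    obtain ⟨f1, ⟨f2, -⟩, -⟩ := h.above.first_spec (by omega)
    rw [run_when_pos (by simpa using hr1)]
    refine Improves.pass (.cons (improves_when (A := False) rfl fun ht => absurd ht (by simp [hr1]))
      improves_nil) ?_
    rw [run_block_cons]
    by_cases hhigh : σ.reg .i₁ = k - 1
    · rw [run_when_pos (by simpa [hk] using hhigh)]
      obtain ⟨h1, h2⟩ := (h.sound_same_highest hx0 (by omega) hhigh).choosePath (Agree.refl σ)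
      simp only [eval_add, eval_one, eval_reg] at h2
      refine Improves.pass (.cons (improves_when (A := False) rfl fun ht =>
          absurd ht (by simp [hk, hhigh]))
        (.cons (improves_when (A := False) rfl fun ht => absurd ht (by simp [hk, hhigh]))
        improves_nil)) ⟨h1, fun hT => ?_⟩
      -- A tour is no better, as `1 ≤ i₁ = k - 1` gives `1 + Δ₀ ≤ k`.
      have := hlow hT
      omega
    · rw [run_when_neg (by simpa [hk] using hhigh), run_block_cons]
      by_cases hone : σ.reg .i₁ = 1
      · rw [run_when_pos (by
          simp only [test_and, test_not, test_eq, eval_one, eval_reg, eval_sub, hk]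
          omega)]
        obtain ⟨h1, h2⟩ := (h.sound_same_lowest hx0 hr1 hone).choosePath (Agree.refl σ)
        rw [eval_three] at h2
        refine Improves.pass (.cons (improves_when (A := False) rfl fun ht =>
          absurd ht (by simp [hone])) improves_nil) ⟨h1, fun hT => ?_⟩
        -- Here `i₁ = 1 ≠ k - 1` forces `k ≥ 3`, so neither a tour nor the route through `d` is
        -- shorter than `3`.
        have := hlow hT
        omega
      · rw [run_when_neg (by
          simp only [test_and, test_not, test_eq, eval_one, eval_reg, eval_sub, hk]
          omega), run_block_cons, run_block_nil,
          run_when_pos (by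
          simp only [test_and, test_not, test_eq, eval_one, eval_reg, eval_sub, hk]
          omega), run_block_cons]
        obtain ⟨h1, h2⟩ := (h.sound_same_first hx0 (by omega)).choosePath (Agree.refl σ)
        simp only [eval_add, eval_one, eval_reg, eval_sub, hk] at h2
        refine Improves.conclude (.cons (h.sound_same_unique hx0 hr1).consider improves_nil) h1
          fun hT => ?_
        simp only [eval_add, eval_one, eval_reg]
        -- If `2 * i₁ + 1 > k`, then `2 * (k - i₁) ≤ k`, so one of the two candidates is no longer
        -- than a tour.
        have := hlow hT
        omega
  · rw [run_when_neg (by simpa using hr1), run_block_cons, run_block_nil,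
      run_when_pos (by
          simp only [test_lt, eval_one, eval_reg]
          omega), run_block_cons]
    obtain ⟨h1, h2⟩ := (h.sound_same_clockwise hx0).choosePath (Agree.refl σ)
    rw [eval_reg, hk] at h2
    refine Improves.conclude (.cons (h.sound_same_gap hx0 (by omega)).consider
      (.cons (h.sound_same_first hx0 (by omega)).consider
      (.cons (h.sound_same_last hx0 (by omega)).consider improves_nil))) h1 fun hT => ?_
    simp only [eval_add, eval_one, eval_reg, eval_sub, hk]
    have := hlow hT
    omega

end Candidates

/-! ### Output of the chosen path -/

/-- While the chosen path is being output: the hops output so far lead to signed distance `f` and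
have covered `lo, …, hi - 1`; their number is `N`. -/
structure Emitted {n k : ℕ} (src dst : Server n k) (σ τ : State) (f lo hi : ℤ) (N : ℕ) : Prop where
  reg : ∀ v, v ≠ .p → v ≠ .i → τ.reg v = σ.reg v
  arr : τ.arr = σ.arr
  p_lt : τ.reg .p < k
  p_dvd : (k : ℤ) ∣ τ.reg .p - f
  route : Route src dst τ.out f lo hi
  count : τ.out.length = N

section Emit

variable {n k : ℕ} {src dst : Server n k} {σ τ : State} {f lo hi : ℤ} {N : ℕ}

theorem Emitted.setReg_i (h : Emitted src dst σ τ f lo hi N) (m : ℕ) :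
    Emitted src dst σ (τ.setReg .i m) f lo hi N := by
  have hp : (τ.setReg .i m).reg .p = τ.reg .p := by simp [setReg_reg]
  refine ⟨fun v hv hv' => ?_, h.arr, by rw [hp]; exact h.p_lt, by rw [hp]; exact h.p_dvd,
    h.route, h.count⟩
  rw [setReg_reg, if_neg hv', h.reg v hv hv']

theorem emitMove_c_run (hk : τ.reg .k = k) :
    ((emitMove .c).run τ).out = τ.out ++ [⟨.c, τ.arr .fix (τ.reg .p)⟩] ∧
      ((emitMove .c).run τ).reg .p = if τ.reg .p + 1 = k then 0 else τ.reg .p + 1 := by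
  simp only [emitMove, run_block_cons, run_block_nil, run_emit, run_set, run_when, test_eq,
    eval_get, eval_reg, eval_add, eval_one, eval_zero, setReg_reg, if_true, reduceCtorEq, if_false,
    hk]
  split_ifs <;> simp

theorem emitMove_a_run (hk : τ.reg .k = k) :
    ((emitMove .a).run τ).out = τ.out ++
        [⟨.a, τ.arr .fix ((if τ.reg .p = 0 then k else τ.reg .p) - 1)⟩] ∧
      ((emitMove .a).run τ).reg .p = (if τ.reg .p = 0 then k else τ.reg .p) - 1 := by
  simp only [emitMove, run_block_cons, run_block_nil, run_emit, run_set, run_when, test_eq,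
    eval_get, eval_reg, eval_sub, eval_one, eval_zero, hk]
  split_ifs <;> simp

theorem emitMove_d_run (hk : τ.reg .k = k) :
    ((emitMove .d).run τ).out = τ.out ++
        [⟨.d, τ.arr .fix ((if τ.reg .p = 0 then k else τ.reg .p) - 1)⟩] := by
  simp only [emitMove, run_cond, run_emit, test_eq, eval_get, eval_reg, eval_sub, eval_one,
    eval_zero, hk]
  split_ifs <;> simp

theorem emitMove_frame (m : Move) (τ : State) :
    (∀ v, v ≠ .p → v ≠ .i → ((emitMove m).run τ).reg v = τ.reg v) ∧
      ((emitMove m).run τ).arr = τ.arr := by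
  constructor
  · intro v hv _
    refine run_reg_of_writes ?_ τ
    cases m <;> simp [emitMove, block, Stmt.writes, DPillar.when, hv]
  · funext A
    refine run_arr_of_puts ?_ τ
    cases m <;> rfl

/-- The target value of the bit at signed distance `e`. -/
theorem Emitted.fix_eq (h : Emitted src dst σ τ f lo hi N)
    (hfix : ∀ j, j < k → σ.arr .fix j = dst.row (shift src.col j)) {j : ℕ} {e : ℤ} (hj : j < k)
    (he : (k : ℤ) ∣ j - e) : τ.arr .fix j = dst.row (shift src.col e) := by
  rw [h.arr, hfix j hj, (shift_eq_shift_iff src.col).2 he]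

/-- The program replaces `p = 0` by `k` before decrementing, so that `p` stays in range and
congruent to the position. -/
theorem Emitted.pred (h : Emitted src dst σ τ f lo hi N) :
    (if τ.reg .p = 0 then k else τ.reg .p) - 1 < k ∧
      (k : ℤ) ∣ ((if τ.reg .p = 0 then k else τ.reg .p) - 1 : ℕ) - (f - 1) := by
  have h1 := h.p_lt
  obtain ⟨t, ht⟩ := h.p_dvd
  split_ifs with h0
  · exact ⟨by omega, t + 1, by rw [mul_add, mul_one]; omega⟩
  · exact ⟨by omega, t, by omega⟩

theorem Emitted.clockwise (hk : σ.reg .k = k)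
    (hfix : ∀ j, j < k → σ.arr .fix j = dst.row (shift src.col j))
    (hk2 : 2 ≤ k) (h : Emitted src dst σ τ f lo hi N) :
    Emitted src dst σ ((emitMove .c).run τ) (f + 1) lo (max hi (f + 1)) (N + 1) := by
  obtain ⟨h1, h2⟩ := emitMove_c_run ((h.reg .k (by simp) (by simp)).trans hk)
  obtain ⟨h3, h4⟩ := emitMove_frame .c τ
  have hp := h.p_lt
  rw [h.fix_eq hfix hp h.p_dvd] at h1
  refine ⟨fun v hv hv' => (h3 v hv hv').trans (h.reg v hv hv'), h4.trans h.arr, ?_, ?_, ?_, ?_⟩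
  · rw [h2]
    split_ifs <;> omega
  · obtain ⟨t, ht⟩ := h.p_dvd
    rw [h2]
    split_ifs
    · exact ⟨t - 1, by rw [mul_sub, mul_one]; omega⟩
    · exact ⟨t, by omega⟩
  · rw [h1]
    exact h.route.clockwise hk2
  · rw [h1, List.length_append, h.count]
    rfl

theorem Emitted.anticlockwise (hk : σ.reg .k = k)
    (hfix : ∀ j, j < k → σ.arr .fix j = dst.row (shift src.col j))
    (hk2 : 2 ≤ k) (h : Emitted src dst σ τ f lo hi N) :
    Emitted src dst σ ((emitMove .a).run τ) (f - 1) (min lo (f - 1)) hi (N + 1) := by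
  obtain ⟨h1, h2⟩ := emitMove_a_run ((h.reg .k (by simp) (by simp)).trans hk)
  obtain ⟨h3, h4⟩ := emitMove_frame .a τ
  obtain ⟨p1, p2⟩ := h.pred
  rw [h.fix_eq hfix p1 p2] at h1
  refine ⟨fun v hv hv' => (h3 v hv hv').trans (h.reg v hv hv'), h4.trans h.arr, ?_, ?_, ?_, ?_⟩
  · rw [h2]
    exact p1
  · rw [h2]
    exact p2
  · rw [h1]
    exact h.route.anticlockwise hk2
  · rw [h1, List.length_append, h.count]
    rfl

theorem Emitted.decrementedStatic (hk : σ.reg .k = k)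
    (hfix : ∀ j, j < k → σ.arr .fix j = dst.row (shift src.col j))
    (h : Emitted src dst σ τ f lo hi N) (hf : f = lo)
    (hk' : hi < lo + k) (hm : Marked src dst (f - 1)) :
    Emitted src dst σ ((emitMove .d).run τ) f (f - 1) hi (N + 1) := by
  have h1 := emitMove_d_run ((h.reg .k (by simp) (by simp)).trans hk)
  have h2 := run_reg_of_writes (P := emitMove .d) (w := .p) rfl τ
  obtain ⟨h3, h4⟩ := emitMove_frame .d τ
  obtain ⟨p1, p2⟩ := h.pred
  rw [h.fix_eq hfix p1 p2] at h1
  refine ⟨fun v hv hv' => (h3 v hv hv').trans (h.reg v hv hv'), h4.trans h.arr, ?_, ?_, ?_, ?_⟩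
  · rw [h2]
    exact h.p_lt
  · rw [h2]
    exact h.p_dvd
  · rw [h1]
    exact h.route.decrementedStatic hf hk' hm
  · rw [h1, List.length_append, h.count]
    rfl

theorem Emitted.basicStatic
    (hfix : ∀ j, j < k → σ.arr .fix j = dst.row (shift src.col j))
    (h : Emitted src dst σ τ f lo hi N) (hf : f = hi)
    (hk' : f < lo + k) (hm : Marked src dst f) :
    Emitted src dst σ ((emitMove .b).run τ) f lo (f + 1) (N + 1) := by
  have h1 : ((emitMove .b).run τ).out = τ.out ++ [⟨.b, τ.arr .fix (τ.reg .p)⟩] := rfl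
  rw [h.fix_eq hfix h.p_lt h.p_dvd] at h1
  refine ⟨h.reg, h.arr, h.p_lt, h.p_dvd, ?_, ?_⟩
  · rw [h1]
    exact h.route.basicStatic hf hk' hm
  · rw [h1, List.length_append, h.count]
    rfl

end Emit

/-- The part of the algorithm that compares the candidates. -/
def compareCandidates : Stmt := .cond (.not (.eq 0 Reg.x)) candidatesDistinct candidatesSame

theorem compareCandidates_steps_le (σ : State) : compareCandidates.steps σ ≤ 3000 :=
  (steps_le_size rfl σ).trans (by decide)

theorem output_eq_run {n k : ℕ} (src dst : Server n k) :
    output src dst = (dpillarMin.run (load src dst)).out := by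
  rw [output, Stmt.run]

theorem time_eq_steps {n k : ℕ} (src dst : Server n k) :
    time src dst = dpillarMin.steps (load src dst) := by
  rw [time, Stmt.steps]

-- From here on programs are handled through the lemmas about them, not by evaluating the
-- interpreter.
attribute [local irreducible] Stmt.run Stmt.steps output time

theorem output_eq {n k : ℕ} (src dst : Server n k) : output src dst =
    (outputPath.run (compareCandidates.run (calcParams.run (calcB.run (load src dst))))).out := by
  rw [output_eq_run, dpillarMin, compareCandidates, run_block_cons, run_block_cons, run_block_cons,
    run_block_cons, run_block_nil]

theorem time_eq {n k : ℕ} (src dst : Server n k) : time src dst = calcB.steps (load src dst) +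
    (calcParams.steps (calcB.run (load src dst)) +
      (compareCandidates.steps (calcParams.run (calcB.run (load src dst))) +
        (outputPath.steps (compareCandidates.run (calcParams.run (calcB.run (load src dst)))) +
          1))) := by
  rw [time_eq_steps, dpillarMin, compareCandidates, steps_block_cons, steps_block_cons,
    steps_block_cons, steps_block_cons, steps_block_nil]

section Output

variable {n k : ℕ} {src dst : Server n k} {σ τ : State} {f lo hi : ℤ} {N : ℕ} {v : Reg}

theorem Emitted.loop_c (hk : σ.reg .k = k)
    (hfix : ∀ j, j < k → σ.arr .fix j = dst.row (shift src.col j)) (hk2 : 2 ≤ k)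
    (hv : v ≠ .p) (hv' : v ≠ .i) (h : Emitted src dst σ τ f lo hi N) :
    Emitted src dst σ ((Stmt.loop .i v (emitMove .c)).run τ) (f + σ.reg v) lo
      (max hi (f + σ.reg v)) (N + σ.reg v) := by
  -- The loop reads its exponent in `τ`; only `p` and `i` have changed since `σ`, so it is still the
  -- chosen one.
  rw [← h.reg v hv hv']
  refine run_loop_induction (e := (v : Expr)) (fun j υ => Emitted src dst σ υ (f + j) lo
    (max hi (f + j)) (N + j)) ?_ fun j _ υ hυ => ?_
  · simpa [max_eq_left h.route.2.1] using h
  · convert (hυ.setReg_i j).clockwise hk hfix hk2 using 1 <;> push_cast <;> omega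

theorem Emitted.loop_a (hk : σ.reg .k = k)
    (hfix : ∀ j, j < k → σ.arr .fix j = dst.row (shift src.col j)) (hk2 : 2 ≤ k)
    (hv : v ≠ .p) (hv' : v ≠ .i) (h : Emitted src dst σ τ f lo hi N) :
    Emitted src dst σ ((Stmt.loop .i v (emitMove .a)).run τ) (f - σ.reg v)
      (min lo (f - σ.reg v)) hi (N + σ.reg v) := by
  rw [← h.reg v hv hv']
  refine run_loop_induction (e := (v : Expr)) (fun j υ => Emitted src dst σ υ (f - j)
    (min lo (f - j)) hi (N + j)) ?_ fun j _ υ hυ => ?_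
  · simpa [min_eq_left h.route.1] using h
  · convert (hυ.setReg_i j).anticlockwise hk hfix hk2 using 1 <;> push_cast <;> omega

theorem Emitted.loop_b (hfix : ∀ j, j < k → σ.arr .fix j = dst.row (shift src.col j))
    (hv : v ≠ .p) (hv' : v ≠ .i) (h : Emitted src dst σ τ f lo hi N)
    (hb : σ.reg v = 0 ∨ σ.reg v = 1 ∧ f = hi ∧ f < lo + k ∧ Marked src dst f) :
    Emitted src dst σ ((Stmt.loop .i v (emitMove .b)).run τ) f lo (hi + σ.reg v)
      (N + σ.reg v) := by
  rw [← h.reg v hv hv'] at hb ⊢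
  refine run_loop_induction (e := (v : Expr)) (fun j υ => Emitted src dst σ υ f lo (hi + j)
    (N + j)) (by simpa using h) fun j hj υ hυ => ?_
  rw [eval_reg] at hj
  -- A round is executed, so the exponent is `1` and this is round `0`, where the window has not yet
  -- grown.
  obtain ⟨h1, h2, h3, h4⟩ := hb.resolve_left (by omega)
  convert (hυ.setReg_i j).basicStatic hfix (by omega) h3 h4 using 1 <;> push_cast <;> omega

theorem Emitted.loop_d (hk : σ.reg .k = k)
    (hfix : ∀ j, j < k → σ.arr .fix j = dst.row (shift src.col j))
    (hv : v ≠ .p) (hv' : v ≠ .i) (h : Emitted src dst σ τ f lo hi N)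
    (hd : σ.reg v = 0 ∨ σ.reg v = 1 ∧ f = lo ∧ hi < lo + k ∧ Marked src dst (f - 1)) :
    Emitted src dst σ ((Stmt.loop .i v (emitMove .d)).run τ) f (lo - σ.reg v) hi
      (N + σ.reg v) := by
  rw [← h.reg v hv hv'] at hd ⊢
  refine run_loop_induction (e := (v : Expr)) (fun j υ => Emitted src dst σ υ f (lo - j) hi
    (N + j)) (by simpa using h) fun j hj υ hυ => ?_
  rw [eval_reg] at hj
  obtain ⟨h1, h2, h3, h4⟩ := hd.resolve_left (by omega)
  convert (hυ.setReg_i j).decrementedStatic hk hfix (by omega) (by omega) h4 using 1 <;> push_cast <;> omega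

theorem Route.exists_walk {hs : List Hop} (h : Route src dst hs f lo hi)
    (hb : blend src dst f lo hi = dst) :
    ∃ p : (graph n k).Walk src dst, Describes hs p ∧ p.length = hs.length := by
  obtain ⟨-, -, h⟩ := h
  rwa [hb] at h

/-- A valid path is output as a description of a walk from `src` to `dst`. -/
theorem outputPath_describes (hk2 : 2 ≤ k) {x : ℕ} (hk : σ.reg .k = k)
    (hfix : ∀ j, j < k → σ.arr .fix j = dst.row (shift src.col j)) (hout : σ.out = [])
    (hx : shift src.col x = dst.col)
    (hv : ValidPath src dst x (σ.reg .e₁) (σ.reg .e₂) (σ.reg .e₃) (σ.reg .e₄) (σ.reg .e₅)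
      (σ.reg .e₆) (σ.reg .e₇)) :
    ∃ p : (graph n k).Walk src dst, Describes (outputPath.run σ).out p ∧
      p.length = σ.reg .e₁ + σ.reg .e₂ + σ.reg .e₃ + σ.reg .e₄ + σ.reg .e₅ + σ.reg .e₆ +
        σ.reg .e₇ := by
  obtain ⟨v1, v2, v3, v4, v5, -⟩ := hv
  have start : Emitted src dst σ ((Stmt.set .p 0).run σ) 0 0 0 0 := by
    refine ⟨fun v hv _ => ?_, by rw [run_set, setReg_arr], ?_, ?_, ?_, ?_⟩
    · rw [run_set, setReg_reg, if_neg hv]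
    · simp only [run_set, setReg_reg_self, eval_zero]
      omega
    · simp
    · rw [run_set, setReg_out, hout]
      exact route_nil
    · rw [run_set, setReg_out, hout]
      rfl
  have s1 := start.loop_c hk hfix hk2 (v := .e₁) (by simp) (by simp)
  have s2 := s1.loop_b hfix (v := .e₂) (by simp) (by simp) (by
    rcases v1 with v1 | ⟨a1, a2, a3⟩
    · exact .inl v1
    · exact .inr ⟨a1, by omega, by omega, by rwa [zero_add]⟩)
  have s3 := s2.loop_a hk hfix hk2 (v := .e₃) (by simp) (by simp)
  -- `e₁ ≤ e₃` puts the position at the lower end of the window, and `e₂ + e₃ < k` leaves the bit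
  -- below it uncovered.
  have s4 := s3.loop_d hk hfix (v := .e₄) (by simp) (by simp) (by
    rcases v2 with v2 | ⟨a1, a2, a3, a4⟩
    · exact .inl v2
    · exact .inr ⟨a1, by omega, by omega, by rwa [zero_add]⟩)
  have s5 := s4.loop_c hk hfix hk2 (v := .e₅) (by simp) (by simp)
  -- `e₂ + e₃ ≤ e₅` means that the clockwise run has come back to the top of the window or beyond
  -- it, so the position is its upper end.
  have s6 := s5.loop_b hfix (v := .e₆) (by simp) (by simp) (by
    rcases v3 with v3 | ⟨a1, a2, a3, a4⟩
    · exact .inl v3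
    · exact .inr ⟨a1, by omega, by omega, by rwa [zero_add]⟩)
  have s7 := s6.loop_a hk hfix hk2 (v := .e₇) (by simp) (by simp)
  -- These nested bounds are the ones accumulated by the loops. They simplify to those in
  -- `ValidPath.cover` because static steps occur only at the ends of the window.
  have hblend := blend_eq_dst (src := src) (dst := dst) (f := 0 + σ.reg .e₁ - σ.reg .e₃ +
      σ.reg .e₅ - σ.reg .e₇)
    (lo := min (min 0 (0 + (σ.reg .e₁ : ℤ) - σ.reg .e₃) - σ.reg .e₄)
      (0 + σ.reg .e₁ - σ.reg .e₃ + σ.reg .e₅ - σ.reg .e₇))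
    (hi := max (max 0 (0 + (σ.reg .e₁ : ℤ)) + σ.reg .e₂)
      (0 + σ.reg .e₁ - σ.reg .e₃ + σ.reg .e₅) + σ.reg .e₆)
    (by
      rw [← hx, shift_eq_shift_iff, zero_add]
      exact v4)
    (fun j hj hm => by
      have := v5 j hj hm
      omega)
  obtain ⟨p, hp, hlen⟩ := s7.route.exists_walk hblend
  refine ⟨p, ?_, by rw [hlen, s7.count, zero_add]⟩
  rw [outputPath]
  simp only [run_block_cons, run_block_nil]
  exact hp

end Output

/-! ### Running time -/

theorem calcB_steps_le {n k : ℕ} (src dst : Server n k) :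
    calcB.steps (load src dst) ≤ 100 + 100 * k := by
  have h1 := (steps_le_size (P := Stmt.cond (.lt Reg.dstCol Reg.srcCol)
    (.set .x (Reg.dstCol + Reg.k - Reg.srcCol : Expr))
    (.set .x (Reg.dstCol - Reg.srcCol : Expr))) rfl (load src dst)).trans
    (show _ ≤ 50 by decide)
  have h2 := fun τ => (steps_le_size (P := Stmt.set .p (Reg.srcCol : Expr)) rfl τ).trans
    (show _ ≤ 10 by decide)
  have h3 := fun τ => steps_loop_le τ (v := .i) (e := (Reg.k : Expr)) (body := markRound)
    (c := 99) fun υ => (steps_le_size rfl υ).trans (by decide)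
  simp only [calcB, steps_block_cons, steps_block_nil]
  refine (Nat.add_le_add h1 (Nat.add_le_add (h2 _) (Nat.add_le_add_right (h3 _) 1))).trans ?_
  rw [eval_reg, run_reg_of_writes rfl, run_reg_of_writes rfl]
  have hk : (load src dst).reg .k = k := rfl
  have hc : (Reg.k : Expr).cost = 1 := rfl
  rw [hk, hc]
  omega

theorem calcParams_steps_le (σ : State) : calcParams.steps σ ≤ 100 + 100 * σ.reg .k := by
  have h3 := fun τ => steps_loop_le τ (v := .i) (e := (Reg.k : Expr))
    (body := block [scanAbove, scanBelow])
    (c := 99) fun υ => (steps_le_size rfl υ).trans (by decide)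
  have hrun : calcParams.steps σ = (block [.set .Δ₀ (.get .B 0), .set .Δₓ (.get .B Reg.x),
      .set .r 0, .set .δ 0, .set .s 0, .set .ε 0,
      .loop .i Reg.k (block [scanAbove, scanBelow])]).steps σ := rfl
  rw [hrun]
  simp only [steps_block_cons, steps_block_nil, steps_set]
  have h4 := h3 ((Stmt.set .ε 0).run ((Stmt.set .s 0).run ((Stmt.set .δ 0).run
    ((Stmt.set .r 0).run ((Stmt.set .Δₓ (.get .B Reg.x)).run
      ((Stmt.set .Δ₀ (.get .B 0)).run σ))))))
  rw [eval_reg, run_reg_of_writes rfl, run_reg_of_writes rfl, run_reg_of_writes rfl,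
    run_reg_of_writes rfl, run_reg_of_writes rfl, run_reg_of_writes rfl] at h4
  have c1 : (Reg.k : Expr).cost = 1 := rfl
  have c2 : (0 : Expr).cost = 1 := rfl
  have c3 : (Expr.get .B 0).cost = 2 := rfl
  have c4 : (Expr.get .B Reg.x).cost = 2 := rfl
  omega

theorem emitLoop_steps_le (m : Move) (v : Reg) (τ : State) :
    (Stmt.loop .i v (emitMove m)).steps τ ≤ 50 * τ.reg v + 2 := by
  have := steps_loop_le τ (v := .i) (e := (v : Expr)) (body := emitMove m) (c := 49)
    fun υ => (steps_le_size (by cases m <;> rfl) υ).trans (by cases m <;> decide)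
  have c1 : (v : Expr).cost = 1 := rfl
  rw [c1, eval_reg] at this
  omega

theorem outputPath_steps_le (σ : State) :
    outputPath.steps σ ≤ 100 + 50 * (σ.reg .e₁ + σ.reg .e₂ + σ.reg .e₃ + σ.reg .e₄ + σ.reg .e₅ +
      σ.reg .e₆ + σ.reg .e₇) := by
  simp only [outputPath, steps_block_cons, steps_block_nil]
  obtain ⟨τ₀, h0⟩ : ∃ τ, τ = (Stmt.set .p 0).run σ := ⟨_, rfl⟩
  obtain ⟨τ₁, h1⟩ : ∃ τ, τ = (Stmt.loop .i Reg.e₁ (emitMove .c)).run τ₀ := ⟨_, rfl⟩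
  obtain ⟨τ₂, h2⟩ : ∃ τ, τ = (Stmt.loop .i Reg.e₂ (emitMove .b)).run τ₁ := ⟨_, rfl⟩
  obtain ⟨τ₃, h3⟩ : ∃ τ, τ = (Stmt.loop .i Reg.e₃ (emitMove .a)).run τ₂ := ⟨_, rfl⟩
  obtain ⟨τ₄, h4⟩ : ∃ τ, τ = (Stmt.loop .i Reg.e₄ (emitMove .d)).run τ₃ := ⟨_, rfl⟩
  obtain ⟨τ₅, h5⟩ : ∃ τ, τ = (Stmt.loop .i Reg.e₅ (emitMove .c)).run τ₄ := ⟨_, rfl⟩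
  obtain ⟨τ₆, h6⟩ : ∃ τ, τ = (Stmt.loop .i Reg.e₆ (emitMove .b)).run τ₅ := ⟨_, rfl⟩
  have hset : (Stmt.set .p 0).steps σ = 2 := steps_set _ _ _
  have f0 : ∀ v, v ≠ .p → τ₀.reg v = σ.reg v := by
    intro v hv
    rw [h0, run_set, setReg_reg, if_neg hv]
  -- Each output loop reads its own exponent, which must have survived the earlier loops.
  have frame : ∀ (m : Move) (w v : Reg) (τ : State), v ≠ .p → v ≠ .i →
      ((Stmt.loop .i w (emitMove m)).run τ).reg v = τ.reg v := by
    intro m w v τ hv hv'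
    refine run_reg_of_writes ?_ τ
    cases m <;> simp [emitMove, block, Stmt.writes, DPillar.when, hv, hv']
  have b1 := emitLoop_steps_le .c .e₁ τ₀
  have b2 := emitLoop_steps_le .b .e₂ τ₁
  have b3 := emitLoop_steps_le .a .e₃ τ₂
  have b4 := emitLoop_steps_le .d .e₄ τ₃
  have b5 := emitLoop_steps_le .c .e₅ τ₄
  have b6 := emitLoop_steps_le .b .e₆ τ₅
  have b7 := emitLoop_steps_le .a .e₇ τ₆
  rw [← h0, ← h1, ← h2, ← h3, ← h4, ← h5, ← h6, hset]
  have g1 : τ₀.reg .e₁ = σ.reg .e₁ := f0 _ (by simp)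
  have g2 : τ₁.reg .e₂ = σ.reg .e₂ := by
    rw [h1, frame _ _ _ _ (by simp) (by simp), f0 _ (by simp)]
  have g3 : τ₂.reg .e₃ = σ.reg .e₃ := by
    rw [h2, frame _ _ _ _ (by simp) (by simp), h1, frame _ _ _ _ (by simp) (by simp),
      f0 _ (by simp)]
  have g4 : τ₃.reg .e₄ = σ.reg .e₄ := by
    rw [h3, frame _ _ _ _ (by simp) (by simp), h2, frame _ _ _ _ (by simp) (by simp), h1,
      frame _ _ _ _ (by simp) (by simp), f0 _ (by simp)]
  have g5 : τ₄.reg .e₅ = σ.reg .e₅ := by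
    rw [h4, frame _ _ _ _ (by simp) (by simp), h3, frame _ _ _ _ (by simp) (by simp), h2,
      frame _ _ _ _ (by simp) (by simp), h1, frame _ _ _ _ (by simp) (by simp), f0 _ (by simp)]
  have g6 : τ₅.reg .e₆ = σ.reg .e₆ := by
    rw [h5, frame _ _ _ _ (by simp) (by simp), h4, frame _ _ _ _ (by simp) (by simp), h3,
      frame _ _ _ _ (by simp) (by simp), h2, frame _ _ _ _ (by simp) (by simp), h1,
      frame _ _ _ _ (by simp) (by simp), f0 _ (by simp)]
  have g7 : τ₆.reg .e₇ = σ.reg .e₇ := by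
    rw [h6, frame _ _ _ _ (by simp) (by simp), h5, frame _ _ _ _ (by simp) (by simp), h4,
      frame _ _ _ _ (by simp) (by simp), h3, frame _ _ _ _ (by simp) (by simp), h2,
      frame _ _ _ _ (by simp) (by simp), h1, frame _ _ _ _ (by simp) (by simp), f0 _ (by simp)]
  omega

/-! ### The algorithm as a whole -/

theorem compareCandidates_spec {n k : ℕ} {src dst : Server n k} {σ : State} {ℓ : ℕ}
    (h : Measured src dst σ) (hne : src ≠ dst) :
    Current src dst σ (compareCandidates.run σ) ∧ ((∃ m M f α β, Span src dst ℓ m M f α β) →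
      (compareCandidates.run σ).reg .L ≤ ℓ) := by
  rw [compareCandidates, run_cond]
  simp only [test_not, test_eq, eval_zero, eval_reg]
  split_ifs with hx
  · exact candidatesSame_spec h hne hx.symm
  · exact candidatesDistinct_spec h (Ne.symm hx)

theorem dpillarMin_spec {n k : ℕ} (hk : 2 ≤ k) {src dst : Server n k} (hne : src ≠ dst) :
    (∃ p : (graph n k).Walk src dst, Describes (output src dst) p ∧
      ∀ q : (graph n k).Walk src dst, p.length ≤ q.length) ∧ time src dst ≤ 4000 * k := by
  have hB := calcB_prepared src dst
  have hM := calcParams_measured hB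
  -- The first component does not involve `ℓ`, so any value serves.
  have hcur := (compareCandidates_spec (ℓ := 0) hM hne).1
  have tB := calcB_steps_le src dst
  have tM := calcParams_steps_le (calcB.run (load src dst))
  rw [hB.reg_k] at tM
  obtain ⟨σ, hσ⟩ : ∃ σ, σ = calcParams.run (calcB.run (load src dst)) := ⟨_, rfl⟩
  rw [← hσ] at hM hcur
  have tC := compareCandidates_steps_le σ
  have tO := outputPath_steps_le (compareCandidates.run σ)
  have htotal := hcur.valid.total
  constructor
  · obtain ⟨p, hp, hlen⟩ := outputPath_describes hk
      ((hcur.agree.reg .k rfl).trans hM.reg_k)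
      (by rw [hcur.agree.arr]; exact hM.fix_eq) (hcur.agree.out.trans hM.out_nil) hM.shift_x
      hcur.valid
    refine ⟨p, ?_, fun q => ?_⟩
    · rw [output_eq, ← hσ]
      exact hp
    · rw [hlen, ← hcur.length]
      -- Now `ℓ` is the length of the competing walk `q`, whose span provides the lower bound.
      exact (compareCandidates_spec hM hne).2 (exists_span q)
  · rw [time_eq, ← hσ]
    -- The parts add up to at most `3301 + 350 * k`, the output contributing `50` for each of at
    -- most `3 * k` hops.
    omega

end DPillar

attribute [local irreducible] DPillar.output DPillar.time in
theorem mainTheorem1 :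
    ∃ C : ℕ, ∀ n k : ℕ, 2 ≤ n → Even n → 2 ≤ k →
      ∀ src dst : DPillar.Server n k, src ≠ dst →
        (∃ p : (DPillar.graph n k).Walk src dst,
          DPillar.Describes (DPillar.output src dst) p ∧
          p.IsPath ∧
          ∀ q : (DPillar.graph n k).Walk src dst, p.length ≤ q.length) ∧
        DPillar.time src dst ≤ C * k := by
  refine ⟨4000, fun n k _ _ hk src dst hne => ?_⟩
  obtain ⟨⟨p, hp, hmin⟩, htime⟩ := DPillar.dpillarMin_spec hk hne
  -- A walk whose length is the distance repeats no server, so minimality already gives a path.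
  refine ⟨⟨p, hp, p.isPath_of_length_eq_dist (le_antisymm ?_ (SimpleGraph.dist_le p)), hmin⟩, htime⟩
  obtain ⟨q, hq⟩ := p.reachable.exists_walk_length_eq_dist
  exact (hmin q).trans hq.le
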